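/- Let $(R,\mathfrak m)$ be a commutative Noetherian local ring which is analytically unramified, that is, its $\mathfrak m$-adic completion is reduced. Let $\overline R$ be the integral closure of $R$ in its total ring of fractions, and let $\mathfrak C=\operatorname{Ann}_R(\overline R/R)$ be the conductor ideal. Suppose that 1. $\dim R=2$; 2. $\operatorname{Gdim}_R(\mathfrak C)<\infty$, that is, there is an exact sequence $0\to G_n\to\cdots\to G_0\to\mathfrak C\to 0$ for some $n\ge 0$ with every $G_i$ totally reflexive (a finitely generated $R$-module $G$ is totally reflexive if the natural map $G\to G^{**}$ is an isomorphism and $\operatorname{Ext}^i_R(G,R)=\operatorname{Ext}^i_R(G^*,R)=0$ for all $i>0$, where $(-)^*=\operatorname{Hom}_R(-,R)$); 3. the $R$-module $\overline R$ is reflexive, that is, the natural map $\overline R\to\overline R^{**}$ is an isomorphism. Then $R$ is quasi-normal, that is, it satisfies - $(S_2)$: $\operatorname{depth}(R_{\mathfrak p})\ge\min\{2,\operatorname{ht}\mathfrak p\}$ for every prime ideal $\mathfrak p$ of $R$; and - $(G_1)$: $R_{\mathfrak p}$ is Gorenstein for every prime ideal $\mathfrak p$ of $R$ of height at most $1$.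 -/

import Mathlib

universe u

open CategoryTheory

noncomputable section

/-- The normalization of `R`: the integral closure of `R` in its total ring of fractions (the
localization of `R` at the set of all its non-zero-divisors). -/
abbrev Normalization (R : Type u) [CommRing R] : Subalgebra R (FractionRing R) :=
  integralClosure R (FractionRing R)

/-- The conductor ideal: the annihilator of the `R`-module `Normalization R / R`. -/
def conductorIdeal (R : Type u) [CommRing R] : Ideal R :=
  Module.annihilator R
    (Normalization R ⧸ LinearMap.range (Algebra.linearMap R (Normalization R)))

/-- A local ring is analytically unramified if its completion in the topology of the maximal
ideal is reduced. -/
def IsAnalyticallyUnramified (R : Type u) [CommRing R] [IsLocalRing R] : Prop :=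
  IsReduced (AdicCompletion (IsLocalRing.maximalIdeal R) R)

/-- The depth of a local ring: the supremum of the lengths of the regular sequences in the
maximal ideal. -/
def localRingDepth (R : Type u) [CommRing R] [IsLocalRing R] : ℕ∞ :=
  ⨆ (rs : List R) (_ : (∀ r ∈ rs, r ∈ IsLocalRing.maximalIdeal R) ∧
    RingTheory.Sequence.IsRegular R rs), (rs.length : ℕ∞)

/-- Serre's condition `(S_n)`: the depth of the localization at any prime `p` is at least
`min n (height p)`. -/
def SatisfiesSerreS (n : ℕ) (R : Type u) [CommRing R] : Prop :=
  ∀ (p : Ideal R) [p.IsPrime],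
    min (n : ℕ∞) p.height ≤ localRingDepth (Localization.AtPrime p)

/-- A Gorenstein local ring: a Noetherian local ring that has finite injective dimension as a
module over itself. -/
structure IsGorensteinLocalRing (R : Type u) [CommRing R] : Prop where
  isNoetherianRing : IsNoetherianRing R
  isLocalRing : IsLocalRing R
  exists_hasInjectiveDimensionLE : ∃ n : ℕ, HasInjectiveDimensionLE (ModuleCat.of R R) n

/-- The condition `(G_n)`: the localization at any prime of height at most `n` is Gorenstein. -/
def SatisfiesG (n : ℕ) (R : Type u) [CommRing R] : Prop :=
  ∀ (p : Ideal R) [p.IsPrime], p.height ≤ (n : ℕ∞) →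
    IsGorensteinLocalRing (Localization.AtPrime p)

/-- A ring is quasi-normal if it satisfies `(S_2)` and `(G_1)`. -/
structure IsQuasiNormal (R : Type u) [CommRing R] : Prop where
  serreS_two : SatisfiesSerreS 2 R
  g_one : SatisfiesG 1 R

/-- A totally reflexive module: a finitely generated reflexive module `M` such that
`Ext^i(M, R) = 0` and `Ext^i(M^*, R) = 0` for all `i > 0`. -/
structure IsTotallyReflexive (R : Type u) [CommRing R] (M : Type u) [AddCommGroup M]
    [Module R M] : Prop where
  finite : Module.Finite R M
  isReflexive : Module.IsReflexive R M
  ext_eq_zero : ∀ i : ℕ, 0 < i →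
    Subsingleton (Abelian.Ext (ModuleCat.of R M) (ModuleCat.of R R) i)
  ext_dual_eq_zero : ∀ i : ℕ, 0 < i →
    Subsingleton (Abelian.Ext (ModuleCat.of R (Module.Dual R M)) (ModuleCat.of R R) i)

/-- `HasGDimensionLE R n M`: there is an exact sequence
`0 → G_n → ⋯ → G_1 → G_0 → M → 0` with all `G_i` totally reflexive, given by splicing short
exact sequences `0 → K → G → M → 0`. -/
def HasGDimensionLE (R : Type u) [CommRing R] : ℕ → ModuleCat.{u} R → Prop
  | 0, M => IsTotallyReflexive R M
  | n + 1, M => ∃ (K G : ModuleCat.{u} R) (f : K →ₗ[R] G) (g : G →ₗ[R] M),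
      Function.Injective f ∧ Function.Exact f g ∧ Function.Surjective g ∧
      IsTotallyReflexive R G ∧ HasGDimensionLE R n K

/-- The G-dimension: the least length of a resolution by totally reflexive modules, and `⊤` if
there is none (the zero module gets the value `0` here). -/
def gDimension (R : Type u) [CommRing R] (M : Type u) [AddCommGroup M] [Module R M] : ℕ∞ :=
  ⨅ (n : ℕ) (_ : HasGDimensionLE R n (ModuleCat.of R M)), (n : ℕ∞)

theorem gDimension_lt_top_iff (R : Type u) [CommRing R] (M : Type u) [AddCommGroup M]
    [Module R M] :
    gDimension R M < ⊤ ↔ ∃ n : ℕ, HasGDimensionLE R n (ModuleCat.of R M) := by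
  simp [gDimension, iInf_lt_iff]

end

/-! Write `B` for `Normalization R` and `C` for the conductor. A functional on `B` is multiplication
by its value at `1`, so `C ≅ B*`, and reflexivity turns this into `B ≅ C*`; in particular `B` is
finite over `R`. Moreover `C` is an ideal of `B`, faithful as a `B`-module, and finite G-dimension
makes `Ext^i_R(C, R)` vanish for large `i`.

The engine is `exists_prime_over_invertible` with `exists_module_annihilator_eq`. Let `p` contain a
regular element `x` and be the annihilator in `R` of an element of `B / xB`. As `B` is integrally
closed, some prime `n` of `B` over `p` becomes invertible after inverting some `s ∉ p`. Then, up to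
the factor `s`, `nC` is a direct summand of `C × C`, so `s` kills the high `Ext(C / nC, R)`, and `C
/ nC` has annihilator `p`. At `p` this module becomes a nonzero vector space over the residue field
`κ(p)`; hence `Ext^i(κ(p), R_p) = 0` for large `i`, and `R_p` is Gorenstein.

For `(G_1)`: `R` embeds in its completion, so it is reduced. At height zero `R_p` is then a field;
at height one `p` is minimal over the annihilator of `B / xB`, hence associated to it, and the
engine applies.

For `(S_2)` only the maximal ideal `m` needs work. If a regular `x ∈ m` does not extend to a regular
sequence of length two, `R / xR` has a nonzero socle, and `C`, being torsion-free of finite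
G-dimension, is totally reflexive (`HasGDimensionLE.isTotallyReflexive`). A nonzero map from `C` to
that socle lifts to an element of `C* ≅ B` whose class in `B / xB` has annihilator `m`. The engine,
now in G-dimension zero, gives `Ext^i(R / m, R) = 0` for `i > 1`. This forces primes minimal over
`x` to be maximal, so Krull's theorem contradicts dimension two. -/

/-! ### Long exact sequences for `Ext`, in terms of linear maps and annihilators -/

section ExtTools

open Abelian

variable {R : Type u} [CommRing R]

namespace ModuleExt

variable {K G M X : Type u} [AddCommGroup K] [Module R K] [AddCommGroup G] [Module R G]
  [AddCommGroup M] [Module R M] [AddCommGroup X] [Module R X]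

/-- `Ext^i_R(M, X)`, for modules in the universe of the ring. -/
abbrev ExtMod (R : Type u) [CommRing R] (M X : Type u) [AddCommGroup M] [Module R M]
    [AddCommGroup X] [Module R X] (i : ℕ) : Type u :=
  Ext (ModuleCat.of R M) (ModuleCat.of R X) i

/-- The short complex of modules attached to an exact pair of linear maps. -/
abbrev shortComplex {f : K →ₗ[R] G} {g : G →ₗ[R] M} (hfg : Function.Exact f g) :
    ShortComplex (ModuleCat.{u} R) :=
  ModuleCat.shortComplexOfCompEqZero f g hfg.linearMap_comp_eq_zero

theorem shortExact {f : K →ₗ[R] G} {g : G →ₗ[R] M} (hf : Function.Injective f)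
    (hfg : Function.Exact f g) (hg : Function.Surjective g) : (shortComplex hfg).ShortExact :=
  ModuleCat.shortComplex_shortExact _ hfg hf hg

/-- The map induced on `Ext` in the first variable. -/
noncomputable def precomp (X : Type u) [AddCommGroup X] [Module R X] (f : K →ₗ[R] G) (i : ℕ)
    (e : ExtMod R G X i) : ExtMod R K X i :=
  (Ext.mk₀ (ModuleCat.ofHom f)).comp e (zero_add i)

theorem precomp_comp (f : K →ₗ[R] G) (g : G →ₗ[R] M) (i : ℕ) (e : ExtMod R M X i) :
    precomp X (g ∘ₗ f) i e = precomp X f i (precomp X g i e) := by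
  simp only [precomp, ModuleCat.ofHom_comp]
  rw [Ext.mk₀_comp_mk₀_assoc]

theorem precomp_smul_id (s : R) (i : ℕ) (e : ExtMod R M X i) :
    precomp X (s • (LinearMap.id : M →ₗ[R] M)) i e = s • e := by
  have : ModuleCat.ofHom (s • (LinearMap.id : M →ₗ[R] M)) = s • 𝟙 (ModuleCat.of R M) := rfl
  simp [precomp, this, Ext.mk₀_smul]

/-- Multiplication by `s` on `Ext(K, X)` factors through `Ext(G, X)`. This is the weak form of a
direct summand: splitting is needed only up to `s`. -/
theorem smul_eq_zero_of_factors (f : K →ₗ[R] G) (g : G →ₗ[R] K) (s : R)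
    (h : ∀ k, g (f k) = s • k) (i : ℕ) [Subsingleton (ExtMod R G X i)] (e : ExtMod R K X i) :
    s • e = 0 := by
  have : g ∘ₗ f = s • (LinearMap.id : K →ₗ[R] K) := LinearMap.ext h
  rw [← precomp_smul_id, ← this, precomp_comp, Subsingleton.elim (precomp X g i e) 0]
  simp [precomp]

theorem subsingleton_of_retract (f : K →ₗ[R] G) (g : G →ₗ[R] K) (h : ∀ k, g (f k) = k) (i : ℕ)
    [Subsingleton (ExtMod R G X i)] : Subsingleton (ExtMod R K X i) := by
  refine subsingleton_of_forall_eq 0 fun e ↦ ?_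
  simpa using smul_eq_zero_of_factors (X := X) f g 1 (by simpa using h) i e

theorem subsingleton_of_equiv (f : K ≃ₗ[R] G) (i : ℕ) [Subsingleton (ExtMod R G X i)] :
    Subsingleton (ExtMod R K X i) :=
  subsingleton_of_retract f.toLinearMap f.symm.toLinearMap (by simp) i

theorem subsingleton_of_projective [Module.Projective R M] (i : ℕ) :
    Subsingleton (ExtMod R M X (i + 1)) := by
  have : Projective (ModuleCat.of R M) := (IsProjective.iff_projective M).mp inferInstance
  exact subsingleton_of_forall_eq 0 fun e ↦ Ext.eq_zero_of_projective e

section Exact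

variable {f : K →ₗ[R] G} {g : G →ₗ[R] M} (hf : Function.Injective f)
  (hfg : Function.Exact f g) (hg : Function.Surjective g)

include hf hfg hg

theorem exists_lift (N : Type u) [AddCommGroup N] [Module R N] [Subsingleton (ExtMod R N K 1)]
    (h : N →ₗ[R] M) : ∃ h' : N →ₗ[R] G, g ∘ₗ h' = h := by
  have hS := shortExact hf hfg hg
  obtain ⟨e, he⟩ := Ext.covariant_sequence_exact₃ (ModuleCat.of R N) hS
    (Ext.mk₀ (ModuleCat.ofHom h)) (zero_add 1) (Subsingleton.elim (α := ExtMod R N K 1) _ _)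
  obtain ⟨φ, rfl⟩ := (Ext.mk₀_bijective _ _).2 e
  rw [Ext.mk₀_comp_mk₀] at he
  have := congrArg ModuleCat.Hom.hom ((Ext.mk₀_bijective _ _).1 he)
  exact ⟨φ.hom, this⟩

theorem exists_extension [Subsingleton (ExtMod R M X 1)] (h : K →ₗ[R] X) :
    ∃ h' : G →ₗ[R] X, h' ∘ₗ f = h := by
  have hS := shortExact hf hfg hg
  obtain ⟨e, he⟩ := Ext.contravariant_sequence_exact₁ hS (ModuleCat.of R X)
    (Ext.mk₀ (ModuleCat.ofHom h)) (add_zero 1) (Subsingleton.elim (α := ExtMod R M X 1) _ _)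
  obtain ⟨φ, rfl⟩ := (Ext.mk₀_bijective _ _).2 e
  rw [Ext.mk₀_comp_mk₀] at he
  have := congrArg ModuleCat.Hom.hom ((Ext.mk₀_bijective _ _).1 he)
  exact ⟨φ.hom, this⟩

theorem subsingleton_X₂ (i : ℕ) [Subsingleton (ExtMod R K X i)] [Subsingleton (ExtMod R M X i)] :
    Subsingleton (ExtMod R G X i) := by
  have hS := shortExact hf hfg hg
  refine subsingleton_of_forall_eq 0 fun e ↦ ?_
  obtain ⟨e', rfl⟩ := Ext.contravariant_sequence_exact₂ hS (ModuleCat.of R X) e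
    (Subsingleton.elim (α := ExtMod R K X i) _ _)
  rw [Subsingleton.elim (α := ExtMod R M X i) e' 0, Ext.comp_zero]

theorem smul_eq_zero_X₃ (i : ℕ) (s : R) (hs : ∀ e : ExtMod R K X i, s • e = 0)
    [Subsingleton (ExtMod R G X (i + 1))] (e : ExtMod R M X (i + 1)) : s • e = 0 := by
  have hS := shortExact hf hfg hg
  obtain ⟨e', rfl⟩ := Ext.contravariant_sequence_exact₃ hS (ModuleCat.of R X) e
    (Subsingleton.elim (α := ExtMod R G X (i + 1)) _ _) (add_comm 1 i)
  rw [← Ext.comp_smul, hs e', Ext.comp_zero]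

theorem subsingleton_X₃ (i : ℕ) [Subsingleton (ExtMod R K X i)]
    [Subsingleton (ExtMod R G X (i + 1))] : Subsingleton (ExtMod R M X (i + 1)) := by
  refine subsingleton_of_forall_eq 0 fun e ↦ ?_
  simpa using smul_eq_zero_X₃ (X := X) hf hfg hg i 1 (fun _ ↦ Subsingleton.elim _ _) e

theorem smul_eq_zero_X₁ (i : ℕ) (s : R) (hs : ∀ e : ExtMod R M X (i + 1), s • e = 0)
    [Subsingleton (ExtMod R G X i)] (e : ExtMod R K X i) : s • e = 0 := by
  have hS := shortExact hf hfg hg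
  obtain ⟨e', he'⟩ := Ext.contravariant_sequence_exact₁ hS (ModuleCat.of R X) (s • e)
    (add_comm 1 i) (by rw [Ext.comp_smul]; exact hs _)
  rw [← he', Subsingleton.elim (α := ExtMod R G X i) e' 0, Ext.comp_zero]

theorem subsingleton_X₁ (i : ℕ) [Subsingleton (ExtMod R M X (i + 1))]
    [Subsingleton (ExtMod R G X i)] : Subsingleton (ExtMod R K X i) := by
  refine subsingleton_of_forall_eq 0 fun e ↦ ?_
  simpa using smul_eq_zero_X₁ (X := X) hf hfg hg i 1 (fun _ ↦ Subsingleton.elim _ _) e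

/-- `Ext^1(M, X)` is the cokernel of restriction `Hom(G, X) → Hom(K, X)`. The elementwise form lets
the annihilation be transported to a localization without a base change theorem for `Ext`. -/
theorem smul_ext_one_eq_zero_iff [Subsingleton (ExtMod R G X 1)] (s : R) :
    (∀ e : ExtMod R M X 1, s • e = 0) ↔
      ∀ h : K →ₗ[R] X, ∃ h' : G →ₗ[R] X, h' ∘ₗ f = s • h := by
  have hS := shortExact hf hfg hg
  refine ⟨fun H h ↦ ?_, fun H e ↦ ?_⟩
  · obtain ⟨e, he⟩ := Ext.contravariant_sequence_exact₁ hS (ModuleCat.of R X)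
      (s • Ext.mk₀ (ModuleCat.ofHom h)) (add_zero 1) (by rw [Ext.comp_smul]; exact H _)
    obtain ⟨φ, rfl⟩ := (Ext.mk₀_bijective _ _).2 e
    rw [Ext.mk₀_comp_mk₀, ← Ext.mk₀_smul] at he
    have := congrArg ModuleCat.Hom.hom ((Ext.mk₀_bijective _ _).1 he)
    exact ⟨φ.hom, this⟩
  · obtain ⟨e', rfl⟩ := Ext.contravariant_sequence_exact₃ hS (ModuleCat.of R X) e
      (Subsingleton.elim (α := ExtMod R G X 1) _ _) (add_zero 1)
    obtain ⟨φ, rfl⟩ := (Ext.mk₀_bijective _ _).2 e'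
    obtain ⟨h', hh'⟩ := H φ.hom
    have : s • φ = (shortComplex hfg).f ≫ ModuleCat.ofHom h' := by
      ext k
      exact (LinearMap.congr_fun hh' k).symm
    rw [← Ext.comp_smul, ← Ext.mk₀_smul, this, ← Ext.mk₀_comp_mk₀,
      ShortComplex.ShortExact.extClass_comp_assoc]

theorem subsingleton_ext_one [Subsingleton (ExtMod R G X 1)]
    (H : ∀ h : K →ₗ[R] X, ∃ h' : G →ₗ[R] X, h' ∘ₗ f = h) : Subsingleton (ExtMod R M X 1) := by
  refine subsingleton_of_forall_eq 0 fun e ↦ ?_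
  simpa using (smul_ext_one_eq_zero_iff (X := X) hf hfg hg 1).mpr (by simpa using H) e

end Exact

theorem subsingleton_prod (i : ℕ) [Subsingleton (ExtMod R K X i)]
    [Subsingleton (ExtMod R M X i)] : Subsingleton (ExtMod R (K × M) X i) :=
  subsingleton_X₂ (f := LinearMap.inl R K M) (g := LinearMap.snd R K M)
    LinearMap.inl_injective Function.Exact.inl_snd LinearMap.snd_surjective i

end ModuleExt

end ExtTools

/-! ### Total reflexivity and descent of G-dimension in depth one -/

section TotallyReflexive

open ModuleExt IsLocalRing

variable {R : Type u} [CommRing R]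

theorem HasGDimensionLE.subsingleton_ext {n : ℕ} {M : ModuleCat.{u} R}
    (h : HasGDimensionLE R n M) {i : ℕ} (hi : n < i) : Subsingleton (ExtMod R M R i) := by
  induction n generalizing M i with
  | zero => exact h.ext_eq_zero i hi
  | succ n ih =>
    obtain ⟨K, G, f, g, hf, hfg, hg, hG, hK⟩ := h
    obtain ⟨i, rfl⟩ : ∃ j, i = j + 1 := ⟨i - 1, by omega⟩
    have := ih hK (i := i) (by omega)
    have : Subsingleton (ExtMod R G R (i + 1)) := hG.ext_eq_zero _ (by omega)
    exact subsingleton_X₃ hf hfg hg i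

section Descent

variable {K G M : Type u} [AddCommGroup K] [Module R K] [AddCommGroup G] [Module R G]
  [AddCommGroup M] [Module R M] {f : K →ₗ[R] G} {g : G →ₗ[R] M}

/-- A linear map into `R / xR` lifts to `R` if `Ext^1` vanishes. -/
theorem exists_dual_lift {x : R} (hx : IsSMulRegular R x) (N : Type u) [AddCommGroup N]
    [Module R N] [Subsingleton (ExtMod R N R 1)] (φ : N →ₗ[R] R ⧸ Ideal.span {x}) :
    ∃ Φ : Module.Dual R N, ∀ n, Ideal.Quotient.mk _ (Φ n) = φ n := by
  have hfg : Function.Exact (LinearMap.lsmul R R x) (Ideal.span {x}).mkQ := by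
    intro y
    simp [Ideal.Quotient.eq_zero_iff_mem, Ideal.mem_span_singleton', mul_comm x]
  obtain ⟨Φ, hΦ⟩ := exists_lift (f := LinearMap.lsmul R R x) hx hfg (Submodule.mkQ_surjective _) N φ
  exact ⟨Φ, LinearMap.congr_fun hΦ⟩

/-- A functional with values in `xR` is `x` times a functional. -/
theorem exists_eq_smul_of_forall_mem {x : R} (hx : IsSMulRegular R x) {N : Type*}
    [AddCommGroup N] [Module R N] (φ : Module.Dual R N) (h : ∀ n, φ n ∈ Ideal.span {x}) :
    ∃ ψ : Module.Dual R N, φ = x • ψ := by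
  have h' (n) : ∃ r, x * r = φ n := by
    obtain ⟨r, hr⟩ := Ideal.mem_span_singleton'.mp (h n)
    exact ⟨r, by rw [mul_comm, hr]⟩
  choose ψ hψ using h'
  refine ⟨⟨⟨ψ, fun a b ↦ hx ?_⟩, fun r a ↦ hx ?_⟩, LinearMap.ext fun n ↦ (hψ n).symm⟩
  · simp [mul_add, hψ]
  · simp only [smul_eq_mul, RingHom.id_apply, hψ, map_smul]
    rw [mul_left_comm, hψ]

theorem Module.IsReflexive.eq_of_forall_dual {N : Type*} [AddCommGroup N] [Module R N]
    [Module.IsReflexive R N] {a b : N} (h : ∀ φ : Module.Dual R N, φ a = φ b) : a = b :=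
  (Module.bijective_dual_eval R N).1 (LinearMap.ext h)

theorem Module.IsReflexive.exists_eval {N : Type*} [AddCommGroup N] [Module R N]
    [Module.IsReflexive R N] (Φ : Module.Dual R (Module.Dual R N)) :
    ∃ a : N, ∀ φ, Φ φ = φ a := by
  obtain ⟨a, rfl⟩ := (Module.bijective_dual_eval R N).2 Φ
  exact ⟨a, fun _ ↦ rfl⟩

/-- Surjectivity of `f.dualMap` makes `0 → M* → G* → K* → 0` exact, so that reflexivity and `Ext`
vanishing for `M` follow by comparing the sequence with its double dual. -/
theorem IsTotallyReflexive.of_shortExact (hK : IsTotallyReflexive R K)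
    (hG : IsTotallyReflexive R G) (hf : Function.Injective f) (hfg : Function.Exact f g)
    (hg : Function.Surjective g) (hsurj : Function.Surjective f.dualMap) :
    IsTotallyReflexive R M := by
  have := hK.finite
  have := hG.finite
  have := hK.isReflexive
  have := hG.isReflexive
  have hK1 : Subsingleton (ExtMod R (Module.Dual R K) R 1) := hK.ext_dual_eq_zero 1 one_pos
  have hG1 : Subsingleton (ExtMod R G R 1) := hG.ext_eq_zero 1 one_pos
  have hdual : Function.Exact g.dualMap f.dualMap := by
    intro β
    refine ⟨fun hβ ↦ ?_, ?_⟩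
    · have hle : LinearMap.range f ≤ LinearMap.ker β := by
        rintro _ ⟨k, rfl⟩
        exact LinearMap.congr_fun hβ k
      refine ⟨((LinearMap.range f).liftQ β hle) ∘ₗ
        (hfg.linearEquivOfSurjective hg).symm.toLinearMap, LinearMap.ext fun y ↦ ?_⟩
      have : (hfg.linearEquivOfSurjective hg).symm (g y) = Submodule.Quotient.mk y := by
        rw [LinearEquiv.symm_apply_eq]; rfl
      simp [this]
    · rintro ⟨α, rfl⟩
      exact LinearMap.ext fun k ↦ by simp [hfg.apply_apply_eq_zero k]
  have hginj : Function.Injective g.dualMap := LinearMap.dualMap_injective_of_surjective hg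
  have hext1 : Subsingleton (ExtMod R M R 1) :=
    subsingleton_ext_one hf hfg hg fun h ↦ by
      obtain ⟨β, hβ⟩ := hsurj h
      exact ⟨β, hβ⟩
  refine ⟨Module.Finite.of_surjective g hg, ⟨?_, ?_⟩, ?_, ?_⟩
  · rw [← LinearMap.ker_eq_bot, LinearMap.ker_eq_bot']
    intro m hm
    obtain ⟨h, rfl⟩ := hg m
    -- Evaluation at `h` vanishes on the image of `M*`, so it descends to `K*`; reflexivity of `K`
    -- then exhibits `h` as coming from `K`.
    obtain ⟨Φ, hΦ⟩ : ∃ Φ : Module.Dual R (Module.Dual R K), ∀ β, Φ (f.dualMap β) = β h := by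
      have hle : LinearMap.range g.dualMap ≤ LinearMap.ker (Module.Dual.eval R G h) := by
        rintro _ ⟨γ, rfl⟩
        exact LinearMap.congr_fun hm γ
      refine ⟨((LinearMap.range g.dualMap).liftQ _ hle) ∘ₗ
        (hdual.linearEquivOfSurjective hsurj).symm.toLinearMap, fun β ↦ ?_⟩
      have : (hdual.linearEquivOfSurjective hsurj).symm (f.dualMap β) =
          Submodule.Quotient.mk β := by
        rw [LinearEquiv.symm_apply_eq]; rfl
      simp only [LinearMap.comp_apply, LinearEquiv.coe_coe, this]
      rfl
    obtain ⟨k, hk⟩ := Module.IsReflexive.exists_eval Φ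
    have : h = f k := Module.IsReflexive.eq_of_forall_dual (R := R) fun β ↦ by
      rw [← hΦ, hk]; rfl
    rw [this, hfg.apply_apply_eq_zero]
  · intro θ
    -- `Ext^1(K*, R) = 0` extends `θ` from `M*` to `G*`, where reflexivity of `G` represents it.
    obtain ⟨Θ, hΘ⟩ := exists_extension hginj hdual hsurj θ
    obtain ⟨h, hh⟩ := Module.IsReflexive.exists_eval Θ
    refine ⟨g h, LinearMap.ext fun γ ↦ ?_⟩
    rw [← hΘ, LinearMap.comp_apply, hh]
    rfl
  · intro i hi
    obtain rfl | hi' := Nat.eq_or_lt_of_le hi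
    · exact hext1
    obtain ⟨i, rfl⟩ : ∃ j, i = j + 1 := ⟨i - 1, by omega⟩
    have : Subsingleton (ExtMod R K R i) := hK.ext_eq_zero i (by omega)
    have : Subsingleton (ExtMod R G R (i + 1)) := hG.ext_eq_zero _ hi
    exact subsingleton_X₃ hf hfg hg i
  · intro i hi
    have : Subsingleton (ExtMod R (Module.Dual R G) R i) := hG.ext_dual_eq_zero i hi
    have : Subsingleton (ExtMod R (Module.Dual R K) R (i + 1)) :=
      hK.ext_dual_eq_zero _ (by omega)
    exact subsingleton_X₁ hginj hdual hsurj i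

variable [IsLocalRing R] {x z : R}

/-- A nonzero finitely generated module has a nonzero map to `R / xR` killed by the maximal ideal,
if `R / xR` has a nonzero socle element. -/
theorem exists_map_to_socle (hz : z ∉ Ideal.span {x})
    (hmz : ∀ a ∈ maximalIdeal R, a * z ∈ Ideal.span {x}) {N : Type*} [AddCommGroup N] [Module R N]
    [Module.Finite R N] (P : Submodule R N) (hP : P ≠ ⊤) :
    ∃ φ : N →ₗ[R] R ⧸ Ideal.span {x}, φ ≠ 0 ∧ (∀ n ∈ P, φ n = 0) ∧
      ∀ a ∈ maximalIdeal R, a • φ = 0 := by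
  -- By Nakayama, `N / P` has a nonzero quotient vector space over the residue field, which is then
  -- mapped to the line spanned by `z`.
  have hN : P ⊔ maximalIdeal R • (⊤ : Submodule R N) ≠ ⊤ := by
    intro h
    refine hP (top_le_iff.mp (Submodule.le_of_le_smul_of_le_jacobson_bot
      (Module.finite_def.mp ‹_›) (maximalIdeal_le_jacobson ⊥) h.ge))
  obtain ⟨n, hn⟩ : ∃ n, n ∉ P ⊔ maximalIdeal R • (⊤ : Submodule R N) := by
    by_contra! h
    exact hN (Submodule.eq_top_iff'.mpr h)
  set Q := P ⊔ maximalIdeal R • (⊤ : Submodule R N)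
  let V := N ⧸ Q
  have hV : Module.IsTorsionBySet R V (maximalIdeal R : Set R) := by
    intro v ⟨a, ha⟩
    obtain ⟨m, rfl⟩ := Submodule.Quotient.mk_surjective _ v
    exact (Submodule.Quotient.mk_eq_zero _).mpr
      (Submodule.mem_sup_right (Submodule.smul_mem_smul ha trivial))
  let _ : Module (R ⧸ maximalIdeal R) V := hV.module
  have : IsScalarTower R (R ⧸ maximalIdeal R) V := hV.isScalarTower
  let _ : Field (R ⧸ maximalIdeal R) := Ideal.Quotient.field _
  obtain ⟨ℓ, hℓ⟩ : ∃ ℓ : Module.Dual (R ⧸ maximalIdeal R) V, ℓ (Submodule.Quotient.mk n) ≠ 0 := by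
    by_contra! h
    exact hn ((Submodule.Quotient.mk_eq_zero _).mp
      ((Module.forall_dual_apply_eq_zero_iff (R ⧸ maximalIdeal R) _).mp h))
  let σ : R ⧸ maximalIdeal R →ₗ[R] R ⧸ Ideal.span {x} :=
    (maximalIdeal R).liftQ (LinearMap.toSpanSingleton R _ (Ideal.Quotient.mk _ z)) (by
      intro a ha
      have := Ideal.Quotient.eq_zero_iff_mem.mpr (hmz a ha)
      rw [map_mul] at this
      exact this)
  have hσ : ∀ c, σ c = 0 → c = 0 := by
    intro c hc
    obtain ⟨a, rfl⟩ := Ideal.Quotient.mk_surjective c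
    by_contra hne
    have ha : IsUnit a := by
      by_contra h
      exact hne (Ideal.Quotient.eq_zero_iff_mem.mpr ((mem_maximalIdeal _).mpr h))
    have h1 : Ideal.Quotient.mk (Ideal.span {x}) (a * z) = 0 := by rw [map_mul]; exact hc
    rw [Ideal.Quotient.eq_zero_iff_mem] at h1
    exact hz ((Ideal.unit_mul_mem_iff_mem _ ha).mp h1)
  refine ⟨σ ∘ₗ (ℓ.restrictScalars R) ∘ₗ Q.mkQ, ?_, ?_, ?_⟩
  · intro h
    exact hℓ (hσ _ (LinearMap.congr_fun h n))
  · intro m hm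
    have : Q.mkQ m = 0 := (Submodule.Quotient.mk_eq_zero _).mpr (Submodule.mem_sup_left hm)
    simp only [LinearMap.comp_apply, this, map_zero]
  · intro a ha
    ext m
    have : a • Q.mkQ m = 0 := by
      rw [← map_smul]
      exact (Submodule.Quotient.mk_eq_zero _).mpr
        (Submodule.mem_sup_right (Submodule.smul_mem_smul ha trivial))
    simp only [LinearMap.smul_apply, LinearMap.comp_apply, ← map_smul, this, map_zero,
      LinearMap.zero_apply]

variable [IsNoetherianRing R]

/-- If `R / xR` has depth zero, then the transpose of a monomorphism of totally reflexive modules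
with `x`-torsion-free cokernel is surjective. -/
theorem dualMap_surjective_of_socle (hx : IsSMulRegular R x) (hz : z ∉ Ideal.span {x})
    (hmz : ∀ a ∈ maximalIdeal R, a * z ∈ Ideal.span {x}) (hK : IsTotallyReflexive R K)
    (hG : IsTotallyReflexive R G) (hf : Function.Injective f) (hfg : Function.Exact f g)
    (hM : IsSMulRegular M x) : Function.Surjective f.dualMap := by
  have := hK.finite
  have := hK.isReflexive
  have := hG.isReflexive
  -- A nonzero map from the cokernel of `f.dualMap` to `R / xR` lifts to evaluation at some `k : K`.
  -- Then `f k` is divisible by `x` in `G`, and, `M` being `x`-torsion-free, `k` is divisible by `x`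
  -- in `K`; so the map was zero.
  by_contra hsurj
  obtain ⟨φ, hφ0, hφf, -⟩ := exists_map_to_socle hz hmz (LinearMap.range f.dualMap)
    (fun h ↦ hsurj (LinearMap.range_eq_top.mp h))
  have : Subsingleton (ExtMod R (Module.Dual R K) R 1) := hK.ext_dual_eq_zero 1 one_pos
  obtain ⟨Φ, hΦ⟩ := exists_dual_lift hx _ φ
  obtain ⟨k, hk⟩ := Module.IsReflexive.exists_eval Φ
  have h1 (β : Module.Dual R G) : Module.Dual.eval R G (f k) β ∈ Ideal.span {x} := by
    rw [← Ideal.Quotient.eq_zero_iff_mem, ← hφf _ ⟨β, rfl⟩, ← hΦ, hk]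
    rfl
  obtain ⟨Ψ, hΨ⟩ := exists_eq_smul_of_forall_mem hx _ h1
  obtain ⟨h, hh⟩ := Module.IsReflexive.exists_eval Ψ
  have h2 : f k = x • h := Module.IsReflexive.eq_of_forall_dual (R := R) fun β ↦ by
    have := LinearMap.congr_fun hΨ β
    rw [map_smul, ← hh]
    exact this
  have h3 : g h = 0 := by
    apply hM
    simp only [smul_zero]
    rw [← map_smul, ← h2]
    exact hfg.apply_apply_eq_zero k
  obtain ⟨h', rfl⟩ := (hfg h).mp h3
  have h4 : k = x • h' := hf (by rw [h2, map_smul])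
  refine hφ0 (LinearMap.ext fun α ↦ ?_)
  rw [← hΦ, hk, h4, map_smul, LinearMap.zero_apply, Ideal.Quotient.eq_zero_iff_mem]
  exact Ideal.mul_mem_right _ _ (Ideal.mem_span_singleton_self x)

/-- Over a local ring of depth one, torsion-free modules of finite G-dimension are totally
reflexive. -/
theorem HasGDimensionLE.isTotallyReflexive (hx : IsSMulRegular R x) (hz : z ∉ Ideal.span {x})
    (hmz : ∀ a ∈ maximalIdeal R, a * z ∈ Ideal.span {x}) {n : ℕ} {M : ModuleCat.{u} R}
    (h : HasGDimensionLE R n M) (hM : IsSMulRegular M x) : IsTotallyReflexive R M := by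
  induction n generalizing M with
  | zero => exact h
  | succ n ih =>
    obtain ⟨K, G, f, g, hf, hfg, hg, hG, hK⟩ := h
    have := hG.isReflexive
    have hGx : IsSMulRegular G x := by
      intro a b hab
      refine Module.IsReflexive.eq_of_forall_dual (R := R) fun φ ↦ hx ?_
      exact (map_smul φ x a).symm.trans ((congrArg φ hab).trans (map_smul φ x b))
    have hKt := ih hK fun a b hab ↦ hf <| hGx <|
      (map_smul f x a).symm.trans ((congrArg f hab).trans (map_smul f x b))
    exact hKt.of_shortExact hG hf hfg hg
      (dualMap_surjective_of_socle hx hz hmz hKt hG hf hfg hM)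

end Descent

end TotallyReflexive

/-! ### Annihilated `Ext` vanishes after localization -/

section ExtLocalization

open ModuleExt IsLocalRing

variable {R : Type u} [CommRing R]

/-- If `Ext^(i+1)_R(M, R)` is killed by an element of `S`, its analogue over `S⁻¹R` vanishes. -/
theorem subsingleton_ext_localizedModule [IsNoetherianRing R] (S : Submonoid R) {s : R}
    (hs : s ∈ S) (i : ℕ) (M : Type u) [AddCommGroup M] [Module R M] [Module.Finite R M]
    (h : ∀ e : ExtMod R M R (i + 1), s • e = 0) :
    Subsingleton (ExtMod (Localization S) (LocalizedModule S M) (Localization S) (i + 1)) := by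
  induction i using Nat.strong_induction_on generalizing M with | _ i ih => ?_
  obtain ⟨n, g, hg⟩ := Module.Finite.exists_fin' R M
  let K := LinearMap.ker g
  let f : K →ₗ[R] (Fin n → R) := K.subtype
  have hf : Function.Injective f := K.subtype_injective
  have hfg : Function.Exact f g := LinearMap.exact_subtype_ker_map g
  let fS : LocalizedModule S K →ₗ[Localization S] LocalizedModule S (Fin n → R) :=
    IsLocalizedModule.mapExtendScalars S (LocalizedModule.mkLinearMap S K)
    (LocalizedModule.mkLinearMap S (Fin n → R)) (Localization S) f
  let gS : LocalizedModule S (Fin n → R) →ₗ[Localization S] LocalizedModule S M :=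
    IsLocalizedModule.mapExtendScalars S
    (LocalizedModule.mkLinearMap S (Fin n → R))
    (LocalizedModule.mkLinearMap S M) (Localization S) g
  have hfS : Function.Injective fS := IsLocalizedModule.map_injective S _ _ f hf
  have hgS : Function.Surjective gS := IsLocalizedModule.map_surjective S _ _ g hg
  have hfgS : Function.Exact fS gS := IsLocalizedModule.map_exact S _ _ _ f g hfg
  have : Module.Projective (Localization S) (LocalizedModule S (Fin n → R)) :=
    Module.projective_of_isLocalizedModule S (LocalizedModule.mkLinearMap S _)
  have hproj := fun i ↦ subsingleton_of_projective (X := R) (M := Fin n → R) (R := R) i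
  have hprojS := fun i ↦ subsingleton_of_projective (X := Localization S)
    (M := LocalizedModule S (Fin n → R)) (R := Localization S) i
  obtain _ | i := i
  · rw [zero_add] at h ⊢
    have := hproj 0
    have := hprojS 0
    rw [zero_add] at *
    rw [smul_ext_one_eq_zero_iff hf hfg hg] at h
    refine subsingleton_ext_one (R := Localization S) (K := LocalizedModule S K)
      (G := LocalizedModule S (Fin n → R)) (M := LocalizedModule S M) (X := Localization S)
      (f := fS) (g := gS) hfS hfgS hgS fun φ ↦ ?_
    have : Module.FinitePresentation R K := Module.finitePresentation_of_finite R K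
    obtain ⟨ψ, t, hψ⟩ := Module.FinitePresentation.exists_lift_of_isLocalizedModule S
      (Algebra.linearMap R (Localization S))
      ((φ.restrictScalars R) ∘ₗ LocalizedModule.mkLinearMap S K)
    obtain ⟨ψ', hψ'⟩ := h ψ
    let ψS := IsLocalizedModule.mapExtendScalars S (LocalizedModule.mkLinearMap S (Fin n → R))
      (Algebra.linearMap R (Localization S)) (Localization S) ψ'
    -- Here `t` clears the denominators of `φ` and `s` makes the result extend over `R`; both are
    -- units in the localization.
    have key : ψS ∘ₗ fS = algebraMap R (Localization S) (s * t) • φ := by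
      have hinj : Function.Injective (LinearMap.restrictScalars R :
          (LocalizedModule S K →ₗ[Localization S] Localization S) → _) :=
        LinearMap.restrictScalars_injective R
      apply hinj
      apply IsLocalizedModule.ext S (LocalizedModule.mkLinearMap S K)
        (IsLocalizedModule.map_units (Algebra.linearMap R (Localization S)))
      ext k
      have h1 : fS (LocalizedModule.mkLinearMap S K k) =
        LocalizedModule.mkLinearMap S _ (f k) := IsLocalizedModule.map_apply S _ _ f k
      have h2 : ψS (LocalizedModule.mkLinearMap S _ (f k)) =
        algebraMap R (Localization S) (ψ' (f k)) := IsLocalizedModule.map_apply S _ _ ψ' (f k)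
      have h3 : ψ' (f k) = s * ψ k := LinearMap.congr_fun hψ' k
      have h4 : algebraMap R (Localization S) (ψ k) =
        (t : R) • φ (LocalizedModule.mkLinearMap S K k) := LinearMap.congr_fun hψ k
      simp only [LinearMap.comp_apply, LinearMap.restrictScalars_apply, LinearMap.smul_apply]
      rw [h1, h2, h3, map_mul, h4, map_mul, Algebra.smul_def, smul_eq_mul, mul_assoc]
    obtain ⟨w, hw⟩ := (IsLocalization.map_units (Localization S) (⟨s * t, S.mul_mem hs t.2⟩ : S))
    refine ⟨(↑w⁻¹ : Localization S) • ψS, ?_⟩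
    rw [LinearMap.smul_comp, key, ← hw, smul_smul, Units.inv_mul, one_smul]
  · have := hproj i
    have := hprojS (i + 1)
    have hK : ∀ e : ExtMod R K R (i + 1), s • e = 0 := smul_eq_zero_X₁ hf hfg hg (i + 1) s h
    have : Subsingleton (ExtMod (Localization S) (LocalizedModule S K) (Localization S) (i + 1)) :=
      ih i (Nat.lt_succ_self i) K hK
    exact subsingleton_X₃ (R := Localization S) (K := LocalizedModule S K)
      (G := LocalizedModule S (Fin n → R)) (M := LocalizedModule S M) (X := Localization S)
      (f := fS) (g := gS) hfS hfgS hgS (i + 1)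

end ExtLocalization

/-! ### From `Ext` of the residue field to `Ext` of cyclic modules -/

section ResidueField

open ModuleExt IsLocalRing

variable {R : Type u} [CommRing R] {X : Type u} [AddCommGroup X] [Module R X]

/-- The residue field is a retract of any nonzero module killed by the maximal ideal. -/
theorem subsingleton_ext_residueField [IsLocalRing R] (V : Type u) [AddCommGroup V] [Module R V]
    [Nontrivial V] (hV : ∀ a ∈ maximalIdeal R, ∀ v : V, a • v = 0) (i : ℕ)
    [Subsingleton (ExtMod R V X i)] : Subsingleton (ExtMod R (R ⧸ maximalIdeal R) X i) := by
  have hV' : Module.IsTorsionBySet R V (maximalIdeal R : Set R) := fun v a ↦ hV a a.2 v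
  let _ : Module (R ⧸ maximalIdeal R) V := hV'.module
  have : IsScalarTower R (R ⧸ maximalIdeal R) V := hV'.isScalarTower
  let _ : Field (R ⧸ maximalIdeal R) := Ideal.Quotient.field _
  obtain ⟨v, hv⟩ := exists_ne (0 : V)
  obtain ⟨ℓ, hℓ⟩ : ∃ ℓ : Module.Dual (R ⧸ maximalIdeal R) V, ℓ v ≠ 0 := by
    by_contra! h
    exact hv ((Module.forall_dual_apply_eq_zero_iff (R ⧸ maximalIdeal R) _).mp h)
  refine subsingleton_of_retract
    ((LinearMap.toSpanSingleton (R ⧸ maximalIdeal R) V ((ℓ v)⁻¹ • v)).restrictScalars R)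
    (ℓ.restrictScalars R) (fun k ↦ ?_) i
  simp [hℓ]

variable [IsLocalRing R] [IsNoetherianRing R] [Module.Finite R X]

/-- Since `x` is regular on `R / q`, the long exact sequence makes `x` act surjectively on the
finitely generated module `Ext^i(R / q, X)`; Nakayama kills it. -/
theorem subsingleton_ext_quotient_of_notMem (q : Ideal R) [q.IsPrime] {x : R} (hxq : x ∉ q)
    (hx : x ∈ maximalIdeal R) (i : ℕ)
    [Subsingleton (ExtMod R (R ⧸ (q ⊔ Ideal.span {x})) X (i + 1))] :
    Subsingleton (ExtMod R (R ⧸ q) X i) := by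
  let f : (R ⧸ q) →ₗ[R] (R ⧸ q) := x • LinearMap.id
  let g : (R ⧸ q) →ₗ[R] (R ⧸ (q ⊔ Ideal.span {x})) := Submodule.factor le_sup_left
  have hf : Function.Injective f := by
    rw [← LinearMap.ker_eq_bot, LinearMap.ker_eq_bot']
    intro a ha
    obtain ⟨a, rfl⟩ := Ideal.Quotient.mk_surjective a
    have h1 : Ideal.Quotient.mk q (x * a) = 0 := by rw [map_mul]; exact ha
    rw [Ideal.Quotient.eq_zero_iff_mem] at h1 ⊢
    exact (Ideal.IsPrime.mem_or_mem ‹_› h1).resolve_left hxq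
  have hg : Function.Surjective g := Submodule.factor_surjective _
  have hfg : Function.Exact f g := by
    intro a
    obtain ⟨a, rfl⟩ := Ideal.Quotient.mk_surjective a
    have h1 : g (Ideal.Quotient.mk q a) = 0 ↔ a ∈ q ⊔ Ideal.span {x} :=
      Ideal.Quotient.eq_zero_iff_mem
    rw [h1, Submodule.mem_sup]
    constructor
    · rintro ⟨y, hy, z, hz, rfl⟩
      obtain ⟨c, rfl⟩ := Ideal.mem_span_singleton'.mp hz
      refine ⟨Ideal.Quotient.mk q c, ?_⟩
      rw [map_add, Ideal.Quotient.eq_zero_iff_mem.mpr hy, zero_add, mul_comm, map_mul]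
      rfl
    · rintro ⟨c, hc⟩
      obtain ⟨c, rfl⟩ := Ideal.Quotient.mk_surjective c
      have h2 : Ideal.Quotient.mk q (x * c) = Ideal.Quotient.mk q a := by rw [map_mul]; exact hc
      rw [Ideal.Quotient.eq] at h2
      refine ⟨a - x * c, by simpa using q.neg_mem h2, x * c,
        Ideal.mul_mem_right _ _ (Ideal.mem_span_singleton_self x), by ring⟩
  have hsurj (e : ExtMod R (R ⧸ q) X i) : ∃ e' : ExtMod R (R ⧸ q) X i, x • e' = e := by
    obtain ⟨e', he'⟩ := Abelian.Ext.contravariant_sequence_exact₁ (shortExact hf hfg hg)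
      (ModuleCat.of R X) e (add_comm 1 i)
      (Subsingleton.elim (α := ExtMod R (R ⧸ (q ⊔ Ideal.span {x})) X (i + 1)) _ _)
    exact ⟨e', (precomp_smul_id x i e').symm.trans he'⟩
  have : (⊤ : Submodule R (ExtMod R (R ⧸ q) X i)) = ⊥ := by
    refine Submodule.eq_bot_of_le_smul_of_le_jacobson_bot (maximalIdeal R) _
      (Module.finite_def.mp inferInstance) ?_ (maximalIdeal_le_jacobson ⊥)
    intro e _
    obtain ⟨e', rfl⟩ := hsurj e
    exact Submodule.smul_mem_smul hx trivial
  exact (Submodule.subsingleton_iff R).mp (subsingleton_of_bot_eq_top this.symm)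

/-- Noetherian induction on `I`. A non-maximal prime is handled by adding an element `x ∉ I`; for a
proper non-prime ideal with `a * b ∈ I`, the sequence `0 → R/(I : a) → R/I → R/(I + (a)) → 0` has
strictly larger ideals at both ends. -/
theorem subsingleton_ext_quotient {N : ℕ}
    (h : ∀ i, N < i → Subsingleton (ExtMod R (R ⧸ maximalIdeal R) X i)) (I : Ideal R) :
    ∀ i, N < i → Subsingleton (ExtMod R (R ⧸ I) X i) := by
  induction I using WellFoundedGT.induction with
  | ind I ih =>
    intro i hi
    by_cases htop : I = ⊤
    · subst htop
      have := h i hi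
      have := Ideal.Quotient.subsingleton_iff.mpr (rfl : (⊤ : Ideal R) = ⊤)
      exact subsingleton_of_retract (0 : _ →ₗ[R] (R ⧸ maximalIdeal R)) 0
        (fun _ ↦ Subsingleton.elim _ _) i
    by_cases hI : I.IsPrime
    · by_cases hm : I = maximalIdeal R
      · subst hm
        exact h i hi
      obtain ⟨x, hx, hxI⟩ := SetLike.exists_of_lt ((le_maximalIdeal htop).lt_of_ne hm)
      have := ih (I ⊔ Ideal.span {x}) (by simpa using hxI) (i + 1) (by omega)
      exact subsingleton_ext_quotient_of_notMem I hxI hx i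
    · obtain ⟨a, ha, b, hb, hab⟩ : ∃ a ∉ I, ∃ b ∉ I, a * b ∈ I := by
        by_contra! H
        exact hI ⟨htop, fun {a b} hab ↦ by
          by_contra! h'
          exact H a h'.1 b h'.2 hab⟩
      let J : Ideal R := I.colon {a}
      have hJ (c : R) : c ∈ J ↔ c * a ∈ I := by
        simp [J, Submodule.mem_colon_singleton]
      let f : (R ⧸ J) →ₗ[R] (R ⧸ I) := J.mapQ I (LinearMap.mulRight R a) fun c hc ↦ (hJ c).mp hc
      let g : (R ⧸ I) →ₗ[R] (R ⧸ (I ⊔ Ideal.span {a})) := Submodule.factor le_sup_left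
      have hf : Function.Injective f := by
        rw [← LinearMap.ker_eq_bot, LinearMap.ker_eq_bot']
        intro c hc
        obtain ⟨c, rfl⟩ := Submodule.Quotient.mk_surjective _ c
        exact (Submodule.Quotient.mk_eq_zero _).mpr
          ((hJ c).mpr ((Submodule.Quotient.mk_eq_zero _).mp hc))
      have hfg : Function.Exact f g := by
        intro y
        obtain ⟨y, rfl⟩ := Submodule.Quotient.mk_surjective _ y
        have h1 : g (Submodule.Quotient.mk y) = 0 ↔ y ∈ I ⊔ Ideal.span {a} :=
          Submodule.Quotient.mk_eq_zero _
        rw [h1, Submodule.mem_sup]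
        constructor
        · rintro ⟨y, hy, z, hz, rfl⟩
          obtain ⟨c, rfl⟩ := Ideal.mem_span_singleton'.mp hz
          refine ⟨Submodule.Quotient.mk c, (Submodule.Quotient.eq _).mpr ?_⟩
          simpa using hy
        · rintro ⟨c, hc⟩
          obtain ⟨c, rfl⟩ := Submodule.Quotient.mk_surjective _ c
          have h2 := (Submodule.Quotient.eq _).mp hc
          refine ⟨y - c * a, by simpa using I.neg_mem h2, c * a,
            Ideal.mul_mem_left _ _ (Ideal.mem_span_singleton_self a), by ring⟩
      have hIJ : I < J := by
        refine lt_of_le_of_ne (fun c hc ↦ (hJ c).mpr (I.mul_mem_right _ hc)) fun h' ↦ hb ?_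
        rw [h', hJ, mul_comm]
        exact hab
      have := ih J hIJ i hi
      have := ih (I ⊔ Ideal.span {a}) (by simpa using ha) i hi
      exact subsingleton_X₂ hf hfg (Submodule.factor_surjective _) i

end ResidueField

/-! ### Injective dimension tested on cyclic modules -/

section Baer

open ModuleExt

variable {R : Type u} [CommRing R]

/-- Baer's criterion in dimension `n`: it suffices to test `Ext^(n+1)` on cyclic modules. -/
theorem hasInjectiveDimensionLE_of_ext_quotient (n : ℕ) (X : ModuleCat.{u} R)
    (h : ∀ I : Ideal R, Subsingleton (ExtMod R (R ⧸ I) X (n + 1))) :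
    HasInjectiveDimensionLE X n := by
  induction n generalizing X with
  | zero =>
    rw [HasInjectiveDimensionLE, zero_add, ← injective_iff_hasInjectiveDimensionLT_one,
      ← Module.injective_iff_injective_object, ← Module.Baer.iff_injective]
    intro I φ
    have := h I
    obtain ⟨φ', hφ'⟩ := exists_extension (M := R ⧸ I) I.subtype_injective
      (LinearMap.exact_subtype_mkQ I) (Submodule.mkQ_surjective I) φ
    exact ⟨φ', fun x hx ↦ LinearMap.congr_fun hφ' ⟨x, hx⟩⟩
  | succ n ih =>
    -- Dimension shifting: the cokernel of an embedding of `X` into an injective has its `Ext` in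
    -- one degree lower.
    obtain ⟨E, _, f, _⟩ := EnoughInjectives.presentation X
    have hf : Function.Injective f.hom := (ModuleCat.mono_iff_injective f).mp ‹_›
    have hS := shortExact hf f.hom.exact_map_mkQ_range (Submodule.mkQ_surjective _)
    refine (hS.hasInjectiveDimensionLT_X₃_iff n (by assumption)).mp
      (ih (ModuleCat.of R (E ⧸ LinearMap.range f.hom)) fun I ↦
        subsingleton_of_forall_eq 0 fun e ↦ ?_)
    obtain ⟨e', rfl⟩ := Abelian.Ext.covariant_sequence_exact₃ (ModuleCat.of R (R ⧸ I)) hS e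
      (n₁ := n + 1 + 1) rfl (Subsingleton.elim (h := h I) _ _)
    have : e' = 0 := Abelian.Ext.eq_zero_of_injective e'
    rw [this, Abelian.Ext.zero_comp]

end Baer

/-! ### A locally invertible prime of an integrally closed extension -/

section InvertiblePrime

open ModuleExt

variable {R : Type u} [CommRing R] {B : Type u} [CommRing B] [Algebra R B]

/-- `B` is integrally closed in `B[1/x]`, in the form of a stability condition: `c / x` lies in `B`
as soon as it maps some ideal containing `x` to itself. -/
def IsStableAt (B : Type u) [CommRing B] (x : B) : Prop :=
  ∀ (c : B) (n : Ideal B), x ∈ n → (∀ u ∈ n, ∃ w ∈ n, c * u = x * w) → x ∣ c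

/-- If `B` is finite over `R` and integrally closed in `B[1/x]`, and `p` is associated to `B / xB`,
then some prime of `B` over `p` becomes invertible after inverting an element outside `p`. -/
theorem exists_prime_over_invertible [IsNoetherianRing R] [Module.Finite R B] {x : R}
    (hB : IsStableAt B (algebraMap R B x)) (p : Ideal R)
    [p.IsPrime] (hx : x ∈ p) {b : B}
    (hb : ∀ r : R, algebraMap R B x ∣ algebraMap R B r * b ↔ r ∈ p) :
    ∃ n : Ideal B, n.IsPrime ∧ n.comap (algebraMap R B) = p ∧ ∃ c : B, ∃ u ∈ n, ∃ v ∈ n, ∃ s ∉ p,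
      (∀ y ∈ n, algebraMap R B x ∣ c * y) ∧
      algebraMap R B s * algebraMap R B x = c * u + algebraMap R B x * v := by
  set ξ := algebraMap R B x
  have : IsNoetherianRing B := IsNoetherianRing.of_finite R B
  let I (c : B) : Ideal B := (Ideal.span {ξ}).colon {c}
  have hI (c y : B) : y ∈ I c ↔ ξ ∣ y * c := by
    simp [I, Submodule.mem_colon_singleton, Ideal.mem_span_singleton]
  -- The ideals `(xB : c)` whose contraction to `R` is exactly `p`; a maximal member will be the
  -- required prime.
  let T : Set (Ideal B) := {J | ∃ c, J = I c ∧ ∀ r : R, ξ ∣ algebraMap R B r * c ↔ r ∈ p}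
  obtain ⟨n, ⟨c, rfl, hc⟩, hmax⟩ := set_has_maximal_iff_noetherian.mpr ‹IsNoetherianRing B› T
    ⟨I b, b, rfl, hb⟩
  have hmax' (c' : B) (hle : I c ≤ I c') (hc' : ∀ r : R, ξ ∣ algebraMap R B r * c' ↔ r ∈ p) :
      I c' ≤ I c := by
    by_contra h
    exact hmax _ ⟨c', rfl, hc'⟩ (lt_of_le_not_ge hle h)
  have hle (d : B) : I c ≤ I (d * c) := fun y hy ↦ by
    rw [hI] at hy ⊢
    rw [mul_left_comm]
    exact hy.mul_left d
  have hprime : (I c).IsPrime := by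
    refine ⟨fun h ↦ ?_, fun {y z} hyz ↦ ?_⟩
    · have : (1 : B) ∈ I c := h ▸ trivial
      rw [hI, ← map_one (algebraMap R B), hc] at this
      exact (Ideal.IsPrime.ne_top ‹_›) ((Ideal.eq_top_iff_one p).mpr this)
    · by_contra! h
      by_cases hy : ∀ r : R, ξ ∣ algebraMap R B r * (y * c) ↔ r ∈ p
      · refine h.2 (hmax' _ (hle y) hy ((hI _ _).mpr ?_))
        rw [hI] at hyz
        rwa [← mul_assoc, mul_comm z]
      · push Not at hy
        obtain ⟨r, ⟨h1, h2⟩ | ⟨h1, h2⟩⟩ := hy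
        · have hr (t : R) : ξ ∣ algebraMap R B t * (algebraMap R B r * c) ↔ t ∈ p := by
            rw [← mul_assoc, ← map_mul, hc]
            exact ⟨fun h ↦ (Ideal.IsPrime.mem_or_mem ‹_› h).resolve_right h2,
              fun h ↦ p.mul_mem_right _ h⟩
          refine h.1 (hmax' _ (hle _) hr ((hI _ _).mpr ?_))
          rwa [mul_left_comm]
        · refine h1 ?_
          rw [mul_left_comm]
          exact ((hc r).mpr h2).mul_left y
  have hcomap : (I c).comap (algebraMap R B) = p := by
    ext r
    rw [Ideal.mem_comap, hI, hc]
  have hξ : ξ ∈ I c := by rw [← Ideal.mem_comap, hcomap]; exact hx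
  have hdvd (y : B) (hy : y ∈ I c) : ξ ∣ c * y := by
    rw [hI] at hy
    rwa [mul_comm]
  -- If `c / x` mapped `I c` to itself, stability would give `ξ ∣ c`, that is `1 ∈ I c`.
  obtain ⟨u, hu, hu'⟩ : ∃ u ∈ I c, ∀ w ∈ I c, c * u ≠ ξ * w := by
    by_contra! h
    refine hprime.ne_top ((Ideal.eq_top_iff_one _).mpr ((hI _ _).mpr ?_))
    rw [one_mul]
    exact hB c (I c) hξ h
  obtain ⟨w, hw⟩ := hdvd u hu
  have hwI : w ∉ I c := fun h ↦ hu' w h hw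
  -- Incomparability in an integral extension: enlarging the prime by `w` enlarges its contraction,
  -- which supplies `s ∉ p`.
  have hlt := Ideal.comap_lt_comap_of_integral_mem_sdiff (R := R) (I := I c)
    (J := I c ⊔ Ideal.span {w}) le_sup_left
    ⟨Ideal.mem_sup_right (Ideal.mem_span_singleton_self w), hwI⟩ (Algebra.IsIntegral.isIntegral w)
  rw [hcomap] at hlt
  obtain ⟨s, hs, hsp⟩ := SetLike.exists_of_lt hlt
  obtain ⟨v, hv, z, hz, hs⟩ := Submodule.mem_sup.mp (Ideal.mem_comap.mp hs)
  obtain ⟨w', rfl⟩ := Ideal.mem_span_singleton'.mp hz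
  refine ⟨I c, hprime, hcomap, c, u * w', Ideal.mul_mem_right _ _ hu, v, hv, s, hsp, hdvd, ?_⟩
  rw [← hs, ← mul_assoc, hw]
  ring

variable {M : Type u} [AddCommGroup M] [Module R M] [Module B M] [IsScalarTower R B M]

/-- The relation reads `s = (c / x) u + v`. Hence `m ↦ ((c / x) m, m)` followed by `(a, b) ↦ u a + v
b` is multiplication by `s` on `nM`, factored through `M × M`. -/
theorem smul_ext_eq_zero_of_invertible {x : R} (hx : IsSMulRegular M x) {n : Ideal B} {c u v : B}
    (hu : u ∈ n) (hv : v ∈ n) {s : R} (hc : ∀ y ∈ n, algebraMap R B x ∣ c * y)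
    (h : algebraMap R B s * algebraMap R B x = c * u + algebraMap R B x * v) (i : ℕ)
    [Subsingleton (ExtMod R M R i)]
    (e : ExtMod R (n • (⊤ : Submodule B M) : Submodule B M) R i) : s • e = 0 := by
  have hdiv (m : M) (hm : m ∈ n • (⊤ : Submodule B M)) : ∃ m' : M, x • m' = c • m := by
    induction hm using Submodule.smul_induction_on' with
    | smul a ha m hm =>
      obtain ⟨d, hd⟩ := hc a ha
      refine ⟨d • m, ?_⟩
      rw [smul_smul, hd, mul_smul, algebraMap_smul]
    | add a _ b _ ha hb =>
      obtain ⟨a', ha'⟩ := ha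
      obtain ⟨b', hb'⟩ := hb
      exact ⟨a' + b', by rw [smul_add, smul_add, ha', hb']⟩
  choose δ hδ using hdiv
  let δ' : (n • (⊤ : Submodule B M) : Submodule B M) →ₗ[R] M :=
    { toFun := fun m ↦ δ m m.2
      map_add' := fun a b ↦ hx <| by simp only [smul_add, hδ, Submodule.coe_add]
      map_smul' := fun r a ↦ hx <| by
        simp only [RingHom.id_apply, hδ]
        rw [smul_comm x r, hδ, smul_comm r c]
        rfl }
  let f : (n • (⊤ : Submodule B M) : Submodule B M) →ₗ[R] M × M :=
    δ'.prod ((n • (⊤ : Submodule B M)).subtype.restrictScalars R)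
  let g : M × M →ₗ[R] (n • (⊤ : Submodule B M) : Submodule B M) :=
    { toFun := fun m ↦ ⟨u • m.1 + v • m.2, add_mem (Submodule.smul_mem_smul hu trivial)
        (Submodule.smul_mem_smul hv trivial)⟩
      map_add' := fun a b ↦ by
        ext
        simp only [Prod.fst_add, Prod.snd_add, smul_add, Submodule.coe_add]
        abel
      map_smul' := fun r a ↦ by
        ext
        simp only [Prod.smul_fst, Prod.smul_snd, RingHom.id_apply, smul_comm _ r, ← smul_add]
        rfl }
  have := subsingleton_prod (R := R) (K := M) (M := M) (X := R) i
  refine smul_eq_zero_of_factors f g s (fun m ↦ Subtype.ext (hx ?_)) i e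
  change x • (u • δ m m.2 + v • (m : M)) = x • (s • (m : M))
  rw [smul_add, smul_comm x u, hδ, smul_smul, ← algebraMap_smul B x, ← algebraMap_smul B x,
    smul_smul, ← add_smul, ← algebraMap_smul B s, smul_smul, mul_comm u, ← h, mul_comm]

/-- Vanishing of `Ext(M, R)` for a faithful finite `B`-module `M` passes, up to an element outside
`p`, to a module with annihilator `p`. -/
theorem exists_module_annihilator_eq [IsNoetherianRing R] [Module.Finite R B] {x : R}
    (hB : IsStableAt B (algebraMap R B x)) (p : Ideal R) [p.IsPrime] (hx : x ∈ p) {b : B}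
    (hb : ∀ r : R, algebraMap R B x ∣ algebraMap R B r * b ↔ r ∈ p)
    [Module.Finite R M] [FaithfulSMul B M] (hxM : IsSMulRegular M x) {N : ℕ}
    (hM : ∀ i, N < i → Subsingleton (ExtMod R M R i)) :
    ∃ (V : Type u) (_ : AddCommGroup V) (_ : Module R V), Module.Finite R V ∧
      Module.annihilator R V = p ∧ ∃ s ∉ p, ∀ i, N < i → ∀ e : ExtMod R V R (i + 1), s • e = 0 := by
  obtain ⟨n, hn, hnp, c, u, hu, v, hv, s, hs, hc, h⟩ :=
    exists_prime_over_invertible hB p hx hb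
  let W : Submodule B M := n • ⊤
  have : Module.Finite B M := Module.Finite.of_restrictScalars_finite R B M
  refine ⟨M ⧸ W, inferInstance, inferInstance, ?_, le_antisymm (fun r hr ↦ ?_) (fun r hr ↦ ?_), s,
    hs, fun i hi e ↦ ?_⟩
  · exact Module.Finite.of_surjective (W.mkQ.restrictScalars R) W.mkQ_surjective
  · have h1 : (⟨n, hn⟩ : PrimeSpectrum B) ∈ Module.support B (M ⧸ W) := by
      rw [Module.support_quotient]
      refine ⟨?_, le_refl n⟩
      rw [Module.mem_support_iff_of_finite,
        Module.annihilator_eq_bot.mpr inferInstance]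
      exact bot_le
    rw [Module.mem_support_iff_of_finite] at h1
    rw [← hnp]
    refine h1 (Module.mem_annihilator.mpr fun m ↦ ?_)
    rw [algebraMap_smul]
    exact Module.mem_annihilator.mp hr m
  · rw [← hnp] at hr
    refine Module.mem_annihilator.mpr fun m ↦ ?_
    obtain ⟨m, rfl⟩ := W.mkQ_surjective m
    rw [← algebraMap_smul B, ← map_smul]
    exact (Submodule.Quotient.mk_eq_zero _).mpr (Submodule.smul_mem_smul hr trivial)
  · have := hM (i + 1) (by omega)
    have := hM i hi
    exact smul_eq_zero_X₃ (f := W.subtype.restrictScalars R) (g := W.mkQ.restrictScalars R)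
      W.subtype_injective (LinearMap.exact_subtype_mkQ W) W.mkQ_surjective i s
      (smul_ext_eq_zero_of_invertible hxM hu hv hc h i) e

end InvertiblePrime

/-! ### The normalization and its conductor -/

section NormalizationFacts

variable (R : Type u) [CommRing R]

theorem algebraMap_normalization_injective :
    Function.Injective (algebraMap R (Normalization R)) := by
  intro a b h
  exact IsFractionRing.injective R (FractionRing R) (congrArg Subtype.val h)

theorem isSMulRegular_normalization {x : R} (hx : x ∈ nonZeroDivisors R) :
    IsSMulRegular (Normalization R) x := by
  intro a b h
  have h' : algebraMap R (FractionRing R) x * a = algebraMap R (FractionRing R) x * b := by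
    rw [← Algebra.smul_def, ← Algebra.smul_def]
    exact congrArg Subtype.val h
  exact Subtype.ext ((IsLocalization.map_units (FractionRing R) ⟨x, hx⟩).mul_left_cancel h')

theorem mem_conductorIdeal_iff {r : R} :
    r ∈ conductorIdeal R ↔ ∀ b : Normalization R, ∃ a : R, algebraMap R _ a = r • b := by
  rw [conductorIdeal, Module.mem_annihilator]
  refine ⟨fun h b ↦ ?_, fun h m ↦ ?_⟩
  · exact (Submodule.Quotient.mk_eq_zero _).mp (h (Submodule.Quotient.mk b))
  · obtain ⟨b, rfl⟩ := Submodule.Quotient.mk_surjective _ m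
    exact (Submodule.Quotient.mk_eq_zero _).mpr (h b)

/-- A functional on the normalization is multiplication by its value at `1`. -/
theorem algebraMap_dual_apply (φ : Module.Dual R (Normalization R)) (b : Normalization R) :
    algebraMap R (Normalization R) (φ b) = φ 1 • b := by
  obtain ⟨⟨a, s⟩, h⟩ := IsLocalization.surj (nonZeroDivisors R) (b : FractionRing R)
  have hb : (s : R) • b = a • (1 : Normalization R) := by
    apply Subtype.ext
    change (s : R) • (b : FractionRing R) = a • 1
    rw [Algebra.smul_def, Algebra.smul_def, mul_one, mul_comm]
    exact h
  apply isSMulRegular_normalization R s.2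
  dsimp only
  rw [smul_comm, hb, ← algebraMap_smul (A := Normalization R), smul_eq_mul, ← map_mul,
    ← smul_eq_mul, ← map_smul, hb, map_smul, smul_smul, Algebra.algebraMap_eq_smul_one, smul_eq_mul,
    mul_comm]

/-- The dual of the normalization is the conductor. -/
noncomputable def dualNormalizationEquiv :
    Module.Dual R (Normalization R) ≃ₗ[R] conductorIdeal R :=
  LinearEquiv.ofBijective
    (LinearMap.codRestrict (conductorIdeal R) (LinearMap.applyₗ (1 : Normalization R))
      fun φ ↦ (mem_conductorIdeal_iff R).mpr fun b ↦ ⟨φ b, algebraMap_dual_apply R φ b⟩) (by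
    constructor
    · intro φ ψ h
      have h1 : φ 1 = ψ 1 := congrArg Subtype.val h
      ext b
      apply algebraMap_normalization_injective
      rw [algebraMap_dual_apply, algebraMap_dual_apply, h1]
    · rintro ⟨c, hc⟩
      have hc' := (mem_conductorIdeal_iff R).mp hc
      choose φ hφ using hc'
      let φ' : Module.Dual R (Normalization R) :=
        { toFun := φ
          map_add' := fun a b ↦ algebraMap_normalization_injective R (by simp [hφ])
          map_smul' := fun r a ↦ algebraMap_normalization_injective R (by
            rw [hφ, RingHom.id_apply, smul_eq_mul, map_mul, hφ, smul_comm, Algebra.smul_def r]) }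
      refine ⟨φ', Subtype.ext (algebraMap_normalization_injective R ?_)⟩
      change algebraMap R _ (φ 1) = _
      rw [hφ, Algebra.algebraMap_eq_smul_one])

/-- The conductor as an ideal of the normalization. -/
def normalizationConductor : Ideal (Normalization R) where
  carrier := {b | ∀ b', ∃ a : R, algebraMap R _ a = b * b'}
  add_mem' {b c} hb hc b' := by
    obtain ⟨r, hr⟩ := hb b'
    obtain ⟨s, hs⟩ := hc b'
    exact ⟨r + s, by rw [map_add, hr, hs, add_mul]⟩
  zero_mem' b' := ⟨0, by simp⟩
  smul_mem' d b hb b' := by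
    obtain ⟨r, hr⟩ := hb (d * b')
    exact ⟨r, by rw [hr, smul_eq_mul]; ring⟩

/-- The conductor of `R`, mapped into the conductor as an ideal of the normalization. -/
def conductorMap : conductorIdeal R →ₗ[R] normalizationConductor R where
  toFun c := ⟨algebraMap R _ c, fun b' ↦ by
    obtain ⟨a, ha⟩ := (mem_conductorIdeal_iff R).mp c.2 b'
    exact ⟨a, by rw [ha, Algebra.smul_def]⟩⟩
  map_add' _ _ := Subtype.ext (map_add _ _ _)
  map_smul' r a := Subtype.ext ((map_mul _ _ _).trans (Algebra.smul_def r _).symm)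

/-- The conductor is the same module, seen as an ideal of `R` or of the normalization. -/
noncomputable def conductorEquiv : conductorIdeal R ≃ₗ[R] normalizationConductor R :=
  LinearEquiv.ofBijective (conductorMap R) (by
    constructor
    · intro a b h
      exact Subtype.ext (algebraMap_normalization_injective R (congrArg Subtype.val h))
    · rintro ⟨b, hb⟩
      obtain ⟨a, ha⟩ := hb 1
      rw [mul_one] at ha
      refine ⟨⟨a, (mem_conductorIdeal_iff R).mpr fun b' ↦ ?_⟩, Subtype.ext ha⟩
      obtain ⟨d, hd⟩ := hb b'
      exact ⟨d, by rw [hd, ← ha, Algebra.smul_def]⟩)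

variable {R}

/-- If the normalization is reflexive, it is the dual of the conductor. -/
noncomputable def normalizationEquivDual [Module.IsReflexive R (Normalization R)] :
    Normalization R ≃ₗ[R] Module.Dual R (conductorIdeal R) :=
  Module.evalEquiv R (Normalization R) ≪≫ₗ (dualNormalizationEquiv R).symm.dualMap

theorem finite_normalization_of_isReflexive [IsNoetherianRing R]
    [Module.IsReflexive R (Normalization R)] : Module.Finite R (Normalization R) :=
  Module.Finite.equiv normalizationEquivDual.symm

/-- The determinant trick: `c / x` acts on the finite `R`-module `n`, so Cayley–Hamilton gives a
monic equation, and `n` contains the regular element `x`. Thus `c / x` is integral over `R`. -/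
theorem isStableAt_normalization [IsNoetherianRing R] [Module.Finite R (Normalization R)] {x : R}
    (hx : x ∈ nonZeroDivisors R) :
    IsStableAt (Normalization R) (algebraMap R (Normalization R) x) := by
  intro c n hn h
  have : IsNoetherian R (Normalization R) := isNoetherian_of_isNoetherianRing_of_finite R _
  have : IsNoetherian R n := isNoetherian_of_injective (n.subtype.restrictScalars R)
    n.subtype_injective
  obtain ⟨x', hx'⟩ := IsLocalization.map_units (FractionRing R) (⟨x, hx⟩ : nonZeroDivisors R)
  set ι := algebraMap (Normalization R) (FractionRing R)
  have hι : ι (algebraMap R (Normalization R) x) = x' := hx'.symm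
  have hreg := isSMulRegular_normalization R hx
  choose! w hw hcw using h
  let φ : n →ₗ[R] n :=
    { toFun := fun u ↦ ⟨w u, hw u u.2⟩
      map_add' := fun a b ↦ Subtype.ext <| hreg <| by
        simp only [Submodule.coe_add, smul_add]
        simp only [Algebra.smul_def]
        rw [← hcw _ a.2, ← hcw _ b.2, ← hcw _ (add_mem a.2 b.2), mul_add]
      map_smul' := fun r a ↦ Subtype.ext <| hreg <| by
        have h1 : (↑(r • a) : Normalization R) = r • (a : Normalization R) := rfl
        have h2 : r • (a : Normalization R) ∈ n := (r • a).2
        change x • w ↑(r • a) = x • r • w a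
        rw [h1, smul_comm x r]
        simp only [Algebra.smul_def x]
        rw [← hcw _ a.2, ← hcw _ h2, mul_smul_comm] }
  let y : FractionRing R := ι c * ↑x'⁻¹
  have hφ (u : n) : ι (φ u) = y * ι u := by
    have h1 : ι c * ι u = x' * ι (φ u) := by
      rw [← hι, ← map_mul, ← map_mul]
      exact congrArg ι (hcw u u.2)
    calc ι (φ u) = ↑x'⁻¹ * (x' * ι (φ u)) := by rw [Units.inv_mul_cancel_left]
      _ = _ := by rw [← h1]; ring
  have hpoly (p : Polynomial R) (u : n) :
      ι (Polynomial.aeval φ p u : n) = Polynomial.aeval y p * ι u := by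
    induction p using Polynomial.induction_on generalizing u with
    | C a =>
      rw [Polynomial.aeval_C, Polynomial.aeval_C, Module.algebraMap_end_apply, ← Algebra.smul_def]
      rfl
    | add p q hp hq =>
      rw [map_add, LinearMap.add_apply, Submodule.coe_add, map_add ι, hp, hq, map_add, add_mul]
    | monomial k a ih =>
      rw [pow_succ, ← mul_assoc]
      generalize Polynomial.C a * Polynomial.X ^ k = q at ih ⊢
      rw [map_mul, map_mul, Polynomial.aeval_X, Polynomial.aeval_X,
        Module.End.mul_apply, ih, hφ, mul_assoc _ y]
  obtain ⟨p, hp, hp0⟩ := LinearMap.exists_monic_and_aeval_eq_zero R φ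
  have hy : IsIntegral R y := by
    refine ⟨p, hp, ?_⟩
    -- Evaluating at `x ∈ n` gives `p(y) * x = 0`, and `x` is a unit in the fraction ring.
    have := hpoly p ⟨_, hn⟩
    rw [hp0, LinearMap.zero_apply] at this
    change ι 0 = _ * ι (algebraMap R _ x) at this
    rw [map_zero, hι] at this
    exact x'.isUnit.mul_left_eq_zero.mp this.symm
  refine ⟨⟨y, hy⟩, Subtype.ext ?_⟩
  change ι c = ι (algebraMap R _ x) * y
  rw [hι, mul_comm, mul_assoc, Units.inv_mul, mul_one]

/-- A common denominator of finitely many generators of the normalization is a regular element of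
the conductor. -/
theorem faithfulSMul_normalizationConductor [Module.Finite R (Normalization R)] :
    FaithfulSMul (Normalization R) (normalizationConductor R) := by
  have hfg : (Subalgebra.toSubmodule (Normalization R)).FG := Module.Finite.iff_fg.mp ‹_›
  obtain ⟨a, ha, hint⟩ := FractionalIdeal.isFractional_of_fg (S := nonZeroDivisors R) hfg
  have hmem : algebraMap R (Normalization R) a ∈ normalizationConductor R := fun b' ↦ by
    obtain ⟨r, hr⟩ := hint b' b'.2
    refine ⟨r, Subtype.ext ?_⟩
    rw [← Algebra.smul_def]
    exact hr
  refine ⟨fun {b c} h ↦ ?_⟩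
  have := congrArg Subtype.val (h ⟨_, hmem⟩)
  apply isSMulRegular_normalization R ha
  dsimp only
  rw [Algebra.smul_def, Algebra.smul_def, mul_comm, mul_comm _ c]
  exact this

theorem isSMulRegular_normalizationConductor {x : R} (hx : x ∈ nonZeroDivisors R) :
    IsSMulRegular (normalizationConductor R) x :=
  fun _ _ h ↦ Subtype.ext (isSMulRegular_normalization R hx (congrArg Subtype.val h))

end NormalizationFacts

/-! ### Gorenstein criteria, socles and depth -/

section QuasiNormal

open ModuleExt IsLocalRing

variable {R : Type u} [CommRing R]

theorem IsAnalyticallyUnramified.isReduced [IsLocalRing R] [IsNoetherianRing R]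
    (hR : IsAnalyticallyUnramified R) : IsReduced R := by
  have : IsReduced (AdicCompletion (maximalIdeal R) R) := hR
  exact isReduced_of_injective (algebraMap R (AdicCompletion (maximalIdeal R) R))
    (AdicCompletion.of_injective (maximalIdeal R) R)

/-- In a reduced Noetherian ring, a prime of positive height contains a non-zero-divisor. -/
theorem exists_mem_nonZeroDivisors_of_height_ne_zero [IsNoetherianRing R] [IsReduced R]
    (p : Ideal R) [p.IsPrime] (hp : p.height ≠ 0) : ∃ x ∈ p, x ∈ nonZeroDivisors R := by
  have h : ¬ (p : Set R) ⊆ ⋃ q ∈ minimalPrimes R, (q : Set R) := by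
    rw [Ideal.subset_union_prime_finite (f := fun q ↦ q)
      (minimalPrimes.finite_of_isNoetherianRing R) ⊥ ⊥ (fun q hq _ _ ↦ hq.1.1)]
    rintro ⟨q, hq, hpq⟩
    have : q = p := le_antisymm (hq.2 ⟨inferInstance, bot_le⟩ hpq) hpq
    exact hp (Ideal.height_eq_zero_iff.mpr (this ▸ hq))
  obtain ⟨x, hxp, hx⟩ := Set.not_subset.mp h
  refine ⟨x, hxp, mem_nonZeroDivisors_iff_right.mpr fun y hy ↦ ?_⟩
  have hy' : y ∈ nilradical R := by
    rw [nilradical, ← Ideal.sInf_minimalPrimes]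
    refine Ideal.mem_sInf.mpr fun {q} hq ↦ ?_
    have hq' : q.IsPrime := hq.1.1
    refine (hq'.mem_or_mem (hy ▸ q.zero_mem : y * x ∈ q)).resolve_right fun h ↦ hx ?_
    exact Set.mem_biUnion hq h
  rwa [nilradical_eq_zero] at hy'

theorem isSMulRegular_of_mem_nonZeroDivisors {x : R} (hx : x ∈ nonZeroDivisors R) :
    IsSMulRegular R x :=
  (isSMulRegular_iff_right_eq_zero_of_smul).mpr fun y hy ↦
    mem_nonZeroDivisors_iff_left.mp hx y hy

theorem IsGorensteinLocalRing.of_ext_residueField [IsLocalRing R] [IsNoetherianRing R] (N : ℕ)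
    (h : ∀ i, N < i → Subsingleton (ExtMod R (R ⧸ maximalIdeal R) R i)) :
    IsGorensteinLocalRing R :=
  ⟨inferInstance, inferInstance, N, hasInjectiveDimensionLE_of_ext_quotient N _
    fun I ↦ subsingleton_ext_quotient h I (N + 1) (Nat.lt_succ_self N)⟩

theorem isGorensteinLocalRing_of_height_eq_zero [IsNoetherianRing R] [IsReduced R] (p : Ideal R)
    [p.IsPrime] (hp : p.height = 0) : IsGorensteinLocalRing (Localization.AtPrime p) := by
  have : IsNoetherianRing (Localization.AtPrime p) :=
    IsLocalization.isNoetherianRing p.primeCompl _ inferInstance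
  have hdim : Ring.KrullDimLE 0 (Localization.AtPrime p) := by
    rw [Ring.krullDimLE_iff, IsLocalization.AtPrime.ringKrullDim_eq_height p, hp]
    rfl
  have hm : maximalIdeal (Localization.AtPrime p) = ⊥ := by
    rw [← jacobson_eq_maximalIdeal ⊥ bot_ne_top, Ideal.jacobson_bot,
      Ring.jacobson_eq_nilradical_of_krullDimLE_zero, nilradical_eq_zero]
    rfl
  refine IsGorensteinLocalRing.of_ext_residueField 0 fun i hi ↦ ?_
  obtain ⟨i, rfl⟩ : ∃ j, i = j + 1 := ⟨i - 1, by omega⟩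
  have := subsingleton_of_projective (R := Localization.AtPrime p)
    (M := Localization.AtPrime p) (X := Localization.AtPrime p) i
  exact subsingleton_of_equiv (Submodule.quotEquivOfEqBot _ hm) (i + 1)

/-- A module with annihilator `p` whose higher `Ext` into `R` is killed by an element outside `p`
shows that `R_p` is Gorenstein. -/
theorem isGorensteinLocalRing_of_annihilator_eq [IsNoetherianRing R] (p : Ideal R) [p.IsPrime]
    (V : Type u) [AddCommGroup V] [Module R V] [Module.Finite R V]
    (hV : Module.annihilator R V = p) {s : R} (hs : s ∉ p) {N : ℕ}
    (h : ∀ i, N < i → ∀ e : ExtMod R V R (i + 1), s • e = 0) :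
    IsGorensteinLocalRing (Localization.AtPrime p) := by
  have : IsNoetherianRing (Localization.AtPrime p) :=
    IsLocalization.isNoetherianRing p.primeCompl _ inferInstance
  have hnt : Nontrivial (LocalizedModule p.primeCompl V) := by
    have : (⟨p, inferInstance⟩ : PrimeSpectrum R) ∈ Module.support R V :=
      Module.mem_support_iff_of_finite.mpr hV.le
    exact Module.mem_support_iff.mp this
  refine IsGorensteinLocalRing.of_ext_residueField (N + 1) fun i hi ↦ ?_
  obtain ⟨i, rfl⟩ : ∃ j, i = j + 1 := ⟨i - 1, by omega⟩
  have := subsingleton_ext_localizedModule p.primeCompl hs i V (h i (by omega))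
  refine subsingleton_ext_residueField (R := Localization.AtPrime p)
    (LocalizedModule p.primeCompl V) (fun a ha v ↦ ?_) (i + 1)
  rw [← Localization.AtPrime.map_eq_maximalIdeal] at ha
  have hle : p.map (algebraMap R (Localization.AtPrime p)) ≤
      Module.annihilator (Localization.AtPrime p) (LocalizedModule p.primeCompl V) := by
    refine Ideal.map_le_iff_le_comap.mpr fun r hr ↦ ?_
    refine Module.mem_annihilator.mpr fun v ↦ ?_
    induction v using LocalizedModule.induction_on with
    | _ m t =>
      rw [← hV] at hr
      rw [algebraMap_smul, LocalizedModule.smul'_mk, Module.mem_annihilator.mp hr,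
        LocalizedModule.zero_mk]
  exact Module.mem_annihilator.mp (hle ha) v

/-- A height one prime containing the regular element `x` is associated to `B / xB`, for every
finite extension ring `B` of `R`. -/
theorem exists_socle_of_height_eq_one [IsNoetherianRing R] {B : Type u} [CommRing B] [Algebra R B]
    [Module.Finite R B] (hinj : Function.Injective (algebraMap R B)) (p : Ideal R) [p.IsPrime]
    (hp : p.height = 1) {x : R} (hxp : x ∈ p) (hx : x ∈ nonZeroDivisors R) :
    ∃ b : B, ∀ r : R, algebraMap R B x ∣ algebraMap R B r * b ↔ r ∈ p := by
  let I : Ideal B := Ideal.span {algebraMap R B x}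
  have hmem (b : B) (r : R) : r • (Submodule.Quotient.mk b : B ⧸ I) = 0 ↔
      algebraMap R B x ∣ algebraMap R B r * b := by
    rw [← Submodule.Quotient.mk_smul, Submodule.Quotient.mk_eq_zero, Algebra.smul_def,
      Ideal.mem_span_singleton]
  -- A prime of `B` over `p` contains `x`, hence everything annihilating `1` modulo `xB`.
  have hann : Module.annihilator R (B ⧸ I) ≤ p := by
    obtain ⟨Q, -, hQ, hQp⟩ := Ideal.exists_ideal_over_prime_of_isIntegral (S := B) p ⊥ (by
      rw [← RingHom.ker_eq_comap_bot, (RingHom.injective_iff_ker_eq_bot _).mp hinj]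
      exact bot_le)
    intro r hr
    have h1 := (hmem 1 r).mp (Module.mem_annihilator.mp hr _)
    rw [mul_one] at h1
    rw [← hQp] at hxp ⊢
    exact Q.mem_of_dvd h1 hxp
  have hx' : Ideal.span {x} ≤ Module.annihilator R (B ⧸ I) := by
    rw [Ideal.span_singleton_le_iff_mem]
    refine Module.mem_annihilator.mpr fun m ↦ ?_
    obtain ⟨b, rfl⟩ := Submodule.Quotient.mk_surjective _ m
    exact (hmem b x).mpr (dvd_mul_right _ _)
  have hfin : p.FiniteHeight := ⟨Or.inr (by rw [hp]; exact ENat.one_ne_top)⟩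
  have hmin : p ∈ (Ideal.span {x}).minimalPrimes := by
    refine Ideal.mem_minimalPrimes_of_height_le (hx'.trans hann) ?_
    rw [hp]
    exact Ideal.one_le_height_span_singleton_of_mem_nonZeroDivisors hx
  have hmin' : p ∈ (Module.annihilator R (B ⧸ I)).minimalPrimes :=
    ⟨⟨inferInstance, hann⟩, fun q hq hqp ↦ hmin.2 ⟨hq.1, hx'.trans hq.2⟩ hqp⟩
  have : Module.Finite R (B ⧸ I) :=
    Module.Finite.of_surjective (I.mkQ.restrictScalars R) I.mkQ_surjective
  have hass := Module.associatedPrimes.minimalPrimes_annihilator_subset_associatedPrimes R _ hmin'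
  obtain ⟨-, v, hv⟩ := isAssociatedPrime_iff.mp hass
  obtain ⟨b, rfl⟩ := Submodule.Quotient.mk_surjective _ v
  refine ⟨b, fun r ↦ ?_⟩
  rw [← hmem]
  conv_rhs => rw [hv]
  rw [Submodule.mem_colon_singleton, Submodule.mem_bot]

/-- Totally reflexive conductor and reflexive normalization: the depth-zero socle of `R / xR` gives
one of `B / xB`, `B` being the normalization. -/
theorem exists_socle_normalization [IsLocalRing R] [IsNoetherianRing R]
    [Module.IsReflexive R (Normalization R)] {x z : R} (hx : x ∈ nonZeroDivisors R)
    (hz : z ∉ Ideal.span {x}) (hmz : ∀ a ∈ maximalIdeal R, a * z ∈ Ideal.span {x})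
    [Nontrivial (conductorIdeal R)] [Subsingleton (ExtMod R (conductorIdeal R) R 1)] :
    ∃ b : Normalization R, ∀ r : R, algebraMap R (Normalization R) x ∣
      algebraMap R (Normalization R) r * b ↔ r ∈ maximalIdeal R := by
  have hx' := isSMulRegular_of_mem_nonZeroDivisors hx
  obtain ⟨φ, hφ0, -, hφ⟩ := exists_map_to_socle hz hmz
    (⊥ : Submodule R (conductorIdeal R)) bot_ne_top
  obtain ⟨Φ, hΦ⟩ := exists_dual_lift hx' _ φ
  let e := normalizationEquivDual (R := R)
  -- Through `B ≅ C*`, divisibility by `x` in `B` becomes divisibility of functionals on `C`, that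
  -- is, vanishing modulo `xR`.
  have hdvd (r : R) : algebraMap R (Normalization R) x ∣
      algebraMap R (Normalization R) r * e.symm Φ ↔ ∃ Ψ, r • Φ = x • Ψ := by
    simp only [← Algebra.smul_def, dvd_def]
    constructor
    · rintro ⟨c, hc⟩
      refine ⟨e c, ?_⟩
      rw [← map_smul, ← hc, map_smul, e.apply_symm_apply]
    · rintro ⟨Ψ, hΨ⟩
      exact ⟨e.symm Ψ, by rw [← map_smul, ← map_smul, hΨ]⟩
  refine ⟨e.symm Φ, fun r ↦ ?_⟩
  rw [hdvd]
  constructor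
  · rintro ⟨Ψ, hΨ⟩
    by_contra hr
    obtain ⟨w, rfl⟩ : IsUnit r := by simpa using hr
    refine hφ0 (LinearMap.ext fun c ↦ ?_)
    have h1 : Φ = x • ((↑w⁻¹ : R) • Ψ) := by
      rw [smul_comm, ← hΨ, smul_smul, Units.inv_mul, one_smul]
    rw [← hΦ, h1, LinearMap.zero_apply, Ideal.Quotient.eq_zero_iff_mem]
    exact Ideal.mul_mem_right _ _ (Ideal.mem_span_singleton_self x)
  · intro hr
    refine exists_eq_smul_of_forall_mem hx' _ fun c ↦ ?_
    rw [← Ideal.Quotient.eq_zero_iff_mem]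
    have := LinearMap.congr_fun (hφ r hr) c
    rw [LinearMap.smul_apply, ← hΦ] at this
    exact this

/-- If `Ext^i(k, R) = 0` for `i > 1`, then every prime minimal over a regular element is maximal. -/
theorem eq_maximalIdeal_of_mem_minimalPrimes [IsLocalRing R] [IsNoetherianRing R] {x : R}
    (hx : x ∈ nonZeroDivisors R)
    (h : ∀ i, 1 < i → Subsingleton (ExtMod R (R ⧸ maximalIdeal R) R i)) {q : Ideal R}
    (hq : q ∈ (Ideal.span {x}).minimalPrimes) : q = maximalIdeal R := by
  have hqp : q.IsPrime := hq.1.1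
  by_contra hne
  obtain ⟨y, hy, hyq⟩ := SetLike.exists_of_lt ((le_maximalIdeal hqp.ne_top).lt_of_ne hne)
  have := subsingleton_ext_quotient h (q ⊔ Ideal.span {y}) 2 one_lt_two
  -- With `Ext^1(R / q, R) = 0`, the embedding `R / q → R / xR` lifts to `R`; the lift vanishes
  -- because `x` kills `R / q` but is regular on `R`.
  have : Subsingleton (ExtMod R (R ⧸ q) R 1) := subsingleton_ext_quotient_of_notMem q hyq hy 1
  have hass : IsAssociatedPrime q (R ⧸ Ideal.span {x}) := by
    apply Module.associatedPrimes.minimalPrimes_annihilator_subset_associatedPrimes R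
      (R ⧸ Ideal.span {x})
    rwa [Ideal.annihilator_quotient]
  obtain ⟨-, f, hf⟩ := (isAssociatedPrime_iff_exists_injective_linearMap _ _).mp hass
  have hx' := isSMulRegular_of_mem_nonZeroDivisors hx
  obtain ⟨Φ, hΦ⟩ := exists_dual_lift hx' _ f
  have hΦ0 (c : R ⧸ q) : Φ c = 0 := by
    apply hx'
    dsimp only
    rw [smul_zero, ← map_smul]
    obtain ⟨c, rfl⟩ := Ideal.Quotient.mk_surjective c
    have : x • (Ideal.Quotient.mk q c) = 0 := by
      rw [Algebra.smul_def]
      exact (map_mul (Ideal.Quotient.mk q) x c).symm.trans (Ideal.Quotient.eq_zero_iff_mem.mpr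
        (q.mul_mem_right _ (hq.1.2 (Ideal.mem_span_singleton_self x))))
    rw [this, map_zero]
  refine hqp.ne_top (Ideal.Quotient.subsingleton_iff.mp ⟨fun a b ↦ hf ?_⟩)
  rw [← hΦ, ← hΦ, hΦ0, hΦ0]

theorem length_le_localRingDepth (p : Ideal R) [p.IsPrime] {rs : List R}
    (hrs : RingTheory.Sequence.IsWeaklyRegular R rs) (hmem : ∀ r ∈ rs, r ∈ p) :
    (rs.length : ℕ∞) ≤ localRingDepth (Localization.AtPrime p) := by
  have := hrs.isRegular_of_isLocalization_of_mem (Localization.AtPrime p) p hmem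
  rw [localRingDepth]
  refine le_iSup₂_of_le (rs.map (algebraMap R (Localization.AtPrime p))) ⟨?_, this⟩ (by simp)
  intro r hr
  obtain ⟨r, hr', rfl⟩ := List.mem_map.mp hr
  exact (IsLocalization.AtPrime.to_map_mem_maximal_iff _ p r).mpr (hmem r hr')

open Pointwise in
/-- Either `x` extends to a regular sequence of length two, or `R / xR` has a socle. -/
theorem exists_isSMulRegular_or_exists_socle [IsLocalRing R] [IsNoetherianRing R] (x : R) :
    (∃ y ∈ maximalIdeal R, IsSMulRegular (QuotSMulTop x R) y) ∨
      ∃ z ∉ Ideal.span {x}, ∀ a ∈ maximalIdeal R, a * z ∈ Ideal.span {x} := by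
  rw [or_iff_not_imp_left]
  intro h
  push Not at h
  have hsub : (maximalIdeal R : Set R) ⊆
      ⋃ q ∈ associatedPrimes R (QuotSMulTop x R), (q : Set R) := by
    rw [biUnion_associatedPrimes_eq_compl_regular]
    exact h
  rw [Ideal.subset_union_prime_finite (f := fun q ↦ q) (associatedPrimes.finite R _) ⊥ ⊥
    (fun q hq _ _ ↦ hq.isPrime)] at hsub
  obtain ⟨q, hq, hmq⟩ := hsub
  have hqm : q = maximalIdeal R := le_antisymm (le_maximalIdeal hq.isPrime.ne_top) hmq
  obtain ⟨hprime, v, hv⟩ := isAssociatedPrime_iff.mp hq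
  obtain ⟨z, rfl⟩ := Submodule.Quotient.mk_surjective _ v
  have hmem (r : R) : r * z ∈ Ideal.span {x} ↔ r ∈ q := by
    rw [hv, Submodule.mem_colon_singleton, Submodule.mem_bot, ← Submodule.Quotient.mk_smul,
      Submodule.Quotient.mk_eq_zero, smul_eq_mul, ← Submodule.ideal_span_singleton_smul,
      smul_eq_mul, Ideal.mul_top]
  refine ⟨z, fun hz ↦ ?_, fun a ha ↦ (hmem a).mpr (hmq ha)⟩
  rw [← one_mul z, hmem] at hz
  exact hprime.ne_top ((Ideal.eq_top_iff_one q).mpr hz)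

end QuasiNormal

/-! ### Assembly of the two conditions -/

section Main

open ModuleExt IsLocalRing

variable {R : Type u} [CommRing R]

theorem subsingleton_ext_normalizationConductor {n : ℕ}
    (h : HasGDimensionLE R n (ModuleCat.of R (conductorIdeal R))) {i : ℕ} (hi : n < i) :
    Subsingleton (ExtMod R (normalizationConductor R) R i) := by
  have : Subsingleton (ExtMod R (conductorIdeal R) R i) := h.subsingleton_ext hi
  exact subsingleton_of_equiv (conductorEquiv R).symm i

/-- A socle of `B / xB` over `p`, `B` being the normalization, together with finite G-dimension of
the conductor yields a module with annihilator `p` and small `Ext` into `R`. -/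
theorem exists_module_of_socle_normalization [IsNoetherianRing R]
    [Module.Finite R (Normalization R)] {n : ℕ}
    (h : HasGDimensionLE R n (ModuleCat.of R (conductorIdeal R))) (p : Ideal R) [p.IsPrime]
    {x : R} (hxp : x ∈ p) (hx : x ∈ nonZeroDivisors R) {b : Normalization R}
    (hb : ∀ r : R, algebraMap R (Normalization R) x ∣
      algebraMap R (Normalization R) r * b ↔ r ∈ p) :
    ∃ (V : Type u) (_ : AddCommGroup V) (_ : Module R V), Module.Finite R V ∧
      Module.annihilator R V = p ∧
        ∃ s ∉ p, ∀ i, n < i → ∀ e : ExtMod R V R (i + 1), s • e = 0 := by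
  have := faithfulSMul_normalizationConductor (R := R)
  have : Module.Finite R (normalizationConductor R) := Module.Finite.equiv (conductorEquiv R)
  let _ : Module (Normalization R) (normalizationConductor R) := Submodule.module _
  have : IsScalarTower R (Normalization R) (normalizationConductor R) := Submodule.isScalarTower _
  exact exists_module_annihilator_eq (B := Normalization R) (M := normalizationConductor R)
    (isStableAt_normalization hx)
    p hxp hb (isSMulRegular_normalizationConductor hx)
    (fun i hi ↦ subsingleton_ext_normalizationConductor h hi)

theorem isGorensteinLocalRing_of_height_eq_one [IsNoetherianRing R] [IsReduced R]
    [Module.Finite R (Normalization R)] {n : ℕ}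
    (h : HasGDimensionLE R n (ModuleCat.of R (conductorIdeal R))) (p : Ideal R) [p.IsPrime]
    (hp : p.height = 1) : IsGorensteinLocalRing (Localization.AtPrime p) := by
  obtain ⟨x, hxp, hx⟩ := exists_mem_nonZeroDivisors_of_height_ne_zero p
    (by rw [hp]; exact one_ne_zero)
  obtain ⟨b, hb⟩ := exists_socle_of_height_eq_one (algebraMap_normalization_injective R)
    p hp hxp hx
  obtain ⟨V, _, _, _, hV, s, hs, hext⟩ := exists_module_of_socle_normalization h p hxp hx hb
  exact isGorensteinLocalRing_of_annihilator_eq p V hV hs hext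

/-- If `R / xR` has a socle, then every prime minimal over `x` is maximal. -/
theorem eq_maximalIdeal_of_socle [IsLocalRing R] [IsNoetherianRing R]
    [Module.IsReflexive R (Normalization R)] {n : ℕ}
    (h : HasGDimensionLE R n (ModuleCat.of R (conductorIdeal R))) {x z : R}
    (hxm : x ∈ maximalIdeal R) (hx : x ∈ nonZeroDivisors R) (hz : z ∉ Ideal.span {x})
    (hmz : ∀ a ∈ maximalIdeal R, a * z ∈ Ideal.span {x}) {q : Ideal R}
    (hq : q ∈ (Ideal.span {x}).minimalPrimes) : q = maximalIdeal R := by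
  have := finite_normalization_of_isReflexive (R := R)
  have hfaith := faithfulSMul_normalizationConductor (R := R)
  have hx' := isSMulRegular_of_mem_nonZeroDivisors hx
  have hreg : IsSMulRegular (conductorIdeal R) x :=
    fun a b hab ↦ Subtype.ext (hx' (congrArg Subtype.val hab))
  have htr : IsTotallyReflexive R (conductorIdeal R) := h.isTotallyReflexive hx' hz hmz hreg
  have hnt : Nontrivial (conductorIdeal R) := by
    by_contra hn
    rw [not_nontrivial_iff_subsingleton] at hn
    have : Subsingleton (normalizationConductor R) := (conductorEquiv R).symm.injective.subsingleton
    have h01 : (0 : Normalization R) = 1 := hfaith.eq_of_smul_eq_smul fun c ↦ Subsingleton.elim _ _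
    refine zero_ne_one (algebraMap_normalization_injective R ?_ : (0 : R) = 1)
    rw [map_zero, map_one, h01]
  have : Subsingleton (ExtMod R (conductorIdeal R) R 1) := htr.ext_eq_zero 1 one_pos
  obtain ⟨b, hb⟩ := exists_socle_normalization hx hz hmz
  -- Replacing `n` by `0` is what brings the vanishing of `Ext^i(R / m, R)` down to all `i > 1`.
  have h0 : HasGDimensionLE R 0 (ModuleCat.of R (conductorIdeal R)) := htr
  obtain ⟨V, _, _, _, hV, s, hs, hext⟩ :=
    exists_module_of_socle_normalization h0 (maximalIdeal R) hxm hx hb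
  refine eq_maximalIdeal_of_mem_minimalPrimes hx (fun i hi ↦ ?_) hq
  obtain ⟨i, rfl⟩ : ∃ j, i = j + 1 := ⟨i - 1, by omega⟩
  obtain ⟨w, rfl⟩ : IsUnit s := by simpa using hs
  have : Subsingleton (ExtMod R V R (i + 1)) := subsingleton_of_forall_eq 0 fun e ↦ by
    have := congrArg ((↑w⁻¹ : R) • ·) (hext i (by omega) e)
    simpa [smul_smul] using this
  have : Nontrivial V := by
    by_contra hn
    rw [not_nontrivial_iff_subsingleton] at hn
    refine (maximalIdeal.isMaximal R).ne_top ?_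
    rw [← hV, Module.annihilator_eq_top_iff]
    exact hn
  exact subsingleton_ext_residueField V
    (fun a ha v ↦ Module.mem_annihilator.mp (hV.ge ha) v) (i + 1)

theorem two_le_localRingDepth [IsLocalRing R] [IsNoetherianRing R] [IsReduced R]
    [Module.IsReflexive R (Normalization R)] (hdim : ringKrullDim R = 2) {n : ℕ}
    (h : HasGDimensionLE R n (ModuleCat.of R (conductorIdeal R))) :
    2 ≤ localRingDepth (Localization.AtPrime (maximalIdeal R)) := by
  have hht : (maximalIdeal R).height = 2 := by
    have := maximalIdeal_height_eq_ringKrullDim (R := R)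
    rw [hdim] at this
    exact WithBot.coe_injective this
  obtain ⟨x, hxm, hx⟩ := exists_mem_nonZeroDivisors_of_height_ne_zero (maximalIdeal R)
    (by rw [hht]; exact two_ne_zero)
  obtain ⟨y, hy, hxy⟩ | ⟨z, hz, hmz⟩ := exists_isSMulRegular_or_exists_socle x
  · refine length_le_localRingDepth (maximalIdeal R) (rs := [x, y]) ?_ (by simpa using ⟨hxm, hy⟩)
    simpa using ⟨isSMulRegular_of_mem_nonZeroDivisors hx, hxy⟩
  · exfalso
    obtain ⟨q, hq, -⟩ := Ideal.exists_minimalPrimes_le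
      ((Ideal.span_singleton_le_iff_mem _).mpr hxm)
    have h1 := Ideal.height_le_one_of_isPrincipal_of_mem_minimalPrimes _ q hq
    rw [eq_maximalIdeal_of_socle h hxm hx hz hmz hq, hht] at h1
    exact absurd h1 (by decide)

end Main

theorem mainTheorem7 (R : Type u) [CommRing R] [IsLocalRing R] [IsNoetherianRing R]
    (hR : IsAnalyticallyUnramified R) (hdim : ringKrullDim R = 2)
    (hG : gDimension R (conductorIdeal R) < ⊤)
    (hrefl : Module.IsReflexive R (Normalization R)) :
    IsQuasiNormal R := by
  have := hR.isReduced
  have := finite_normalization_of_isReflexive (R := R)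
  obtain ⟨n, hn⟩ := (gDimension_lt_top_iff R _).mp hG
  refine ⟨fun p _ ↦ ?_, fun p _ hp ↦ ?_⟩
  · by_cases hpm : p = IsLocalRing.maximalIdeal R
    · subst hpm
      exact (min_le_left _ _).trans (two_le_localRingDepth hdim hn)
    · by_cases hp0 : p.height = 0
      · rw [hp0]
        simp
      obtain ⟨x, hxp, hx⟩ := exists_mem_nonZeroDivisors_of_height_ne_zero p hp0
      -- A non-maximal prime in dimension two has height at most one, so one regular element of `p`
      -- suffices for the depth.
      have hle : p.height ≤ 1 := by
        have hht := IsLocalRing.maximalIdeal_height_eq_ringKrullDim (R := R)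
        rw [hdim] at hht
        have hht' : (IsLocalRing.maximalIdeal R).height = 2 := WithBot.coe_injective hht
        have : (p.height : ℕ∞) + 1 ≤ 1 + 1 := by
          refine (Ideal.height_add_one_le_of_lt_of_isPrime
            ((IsLocalRing.le_maximalIdeal (Ideal.IsPrime.ne_top ‹_›)).lt_of_ne hpm)).trans ?_
          rw [hht']
          rfl
        exact (ENat.add_le_add_iff_right ENat.one_ne_top).mp this
      refine (min_le_right _ _).trans (hle.trans ?_)
      exact length_le_localRingDepth p (rs := [x])
        (by simpa using isSMulRegular_of_mem_nonZeroDivisors hx) (by simpa using hxp)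
  · by_cases hp0 : p.height = 0
    · exact isGorensteinLocalRing_of_height_eq_zero p hp0
    · exact isGorensteinLocalRing_of_height_eq_one hn p
        (le_antisymm (by simpa using hp) (Order.one_le_iff_ne_zero.mpr hp0))
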